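/- Let $K\ge1$, $\Omega_1,\dots,\Omega_K>0$ and $\lambda\in\mathbb R$ be fixed. Put $C=\frac1K\sum_{k}\frac12\log_2(1+\Omega_k)$ and, on the real regions where $1+2s\Omega_k>0$ for all $k$ (for $\alpha$) and its translate by $-\frac12$ (for $\beta$), $$\alpha(s)=2\lambda s-\frac1K\sum_{k=1}^K\Big(\frac{2s(1+\Omega_k)}{1+2s\Omega_k}+\ln(1+2s\Omega_k)\Big),\qquad \beta(s)=\alpha(s+\tfrac12)+2\ln(2)\,C+1-\lambda .$$ Let $s_\alpha$ be the minimizer of $\alpha$ over $\{s\in\mathbb R: s>-\frac1{2\Omega_k}\ \forall k\}$, let $s_\beta=s_\alpha-\frac12$, and assume $s_\beta<0<s_\alpha$. For $j\ge2$ let $$a_j=\frac1K\sum_{k=1}^K\Big(\frac{(1+\Omega_k)/\Omega_k}{1+2s_\alpha\Omega_k}+\frac1j\Big)\Big(\frac{-2\Omega_k}{1+2s_\alpha\Omega_k}\Big)^j,\qquad g(s)=\frac{12a_2a_4-15a_3^2}{8a_2^3}-\frac{3a_3}{2a_2^2s}-\frac1{a_2s^2}.$$ Consider $K$ parallel Gaussian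 channels with block powers $P_k>0$, noise variances $\sigma_k^2>0$ and $P_k/\sigma_k^2=\Omega_k$. For $n$ a positive multiple of $K$, a word $b\in\mathbb R^n$ is split into $K$ blocks $b_k$ of length $n/K$. Let $p_{y|x}(\cdot|a)$ be the density of the product over $k$ of $\mathcal N(a_k,\sigma_k^2I)$, let $p_y$ be the density of the product over $k$ of $\mathcal N(0,\sigma_k^2(1+\Omega_k)I)$, and let $\Lambda(a,b)=\frac1n\ln\frac{p_{y|x}(b|a)}{p_y(b)}$. For a codeword $a\in\mathbb R^n$ with $\|a_k\|^2=\frac nKP_k$ for all $k$, and with the likelihood threshold $\theta=\frac12+\ln(2)\,C-\frac\lambda2$, define the false alarm and missed detection probabilities $$P_{\rm FA}=\mathbb P[\Lambda(a,y)\ge\theta],\ y\sim p_y,\qquad P_{\rm MD}=\mathbb P[\Lambda(a,y)<\theta],\ y\sim p_{y|x}(\cdot|a).$$ Then, as $n\to\infty$ along the multiples of $K$, the probabilities $P_{\rm FA}$ and $P_{\rm MD}$ are positive and $$\frac1n\ln P_{\rm FA}=\frac12\alpha(s_\alpha)-\frac1{2n}\ln(2\pi n a_2s_\alpha^2)+O(n^{-2}),\qquad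 \frac1n\ln P_{\rm MD}=\frac12\beta(s_\beta)-\frac1{2n}\ln(2\pi n a_2s_\beta^2)+O(n^{-2}),$$ and moreover, $1+\frac1ng(s_\alpha)$ and $1+\frac1ng(s_\beta)$ being positive for $n$ large, $$\frac1n\ln P_{\rm FA}=\frac12\alpha(s_\alpha)-\frac1{2n}\ln(2\pi n a_2s_\alpha^2)+\frac1n\ln\Big(1+\frac{g(s_\alpha)}n\Big)+O(n^{-3}),$$ $$\frac1n\ln P_{\rm MD}=\frac12\beta(s_\beta)-\frac1{2n}\ln(2\pi n a_2s_\beta^2)+\frac1n\ln\Big(1+\frac{g(s_\beta)}n\Big)+O(n^{-3}).$$ The implied constants, and the threshold on $n$ from which they apply, depend only on $K$, $\Omega_1,\dots,\Omega_K$ and $\lambda$; in particular not on the codeword $a$. -/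

import Mathlib

open MeasureTheory

namespace ParallelAWGN

/-- Words of length `n = K * m` over the reals, partitioned in `K` blocks of equal length `m`. -/
abbrev Word (K m : ℕ) : Type := Fin K → EuclideanSpace ℝ (Fin m)

/-- Admissible codewords: the `k`-th block (of length `m = n / K`) has energy `(n / K) * P k`. -/
def codewords {K : ℕ} (m : ℕ) (P : Fin K → ℝ) : Set (Word K m) :=
  {x | ∀ k, ‖x k‖ ^ 2 = (m : ℝ) * P k}

/-- Transition density `p_{y|x}(b | a)`: block `k` sees white Gaussian noise of variance
`σ k ^ 2` per entry. -/
noncomputable def channelPDF {K m : ℕ} (σ : Fin K → ℝ) (a b : Word K m) : ℝ :=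
  ∏ k, (1 / (2 * Real.pi * σ k ^ 2) ^ ((m : ℝ) / 2)
    * Real.exp (-‖b k - a k‖ ^ 2 / (2 * σ k ^ 2)))

/-- Output density `p_y(b)` induced by the capacity achieving Gaussian input. -/
noncomputable def outputPDF {K m : ℕ} (σ Ω : Fin K → ℝ) (b : Word K m) : ℝ :=
  ∏ k, (1 / (2 * Real.pi * σ k ^ 2 * (1 + Ω k)) ^ ((m : ℝ) / 2)
    * Real.exp (-‖b k‖ ^ 2 / (2 * σ k ^ 2 * (1 + Ω k))))

/-- Law of the output `y` when the codeword `a` is sent. -/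
noncomputable def channelLaw {K m : ℕ} (σ : Fin K → ℝ) (a : Word K m) : Measure (Word K m) :=
  volume.withDensity (fun b => ENNReal.ofReal (channelPDF σ a b))

/-- Auxiliary output law, with density `p_y`. -/
noncomputable def outputLaw {K : ℕ} (m : ℕ) (σ Ω : Fin K → ℝ) : Measure (Word K m) :=
  volume.withDensity (fun b => ENNReal.ofReal (outputPDF σ Ω b))

/-- Normalized log-likelihood ratio `Λ(a, b) = (1 / n) ln (p_{y|x}(b | a) / p_y(b))`. -/
noncomputable def logLikelihood {K m : ℕ} (σ Ω : Fin K → ℝ) (a b : Word K m) : ℝ :=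
  1 / ((K * m : ℕ) : ℝ) * Real.log (channelPDF σ a b / outputPDF σ Ω b)

/-- Neyman-Pearson false alarm probability `P[Λ(a, y) ≥ θ]`, `y ∼ p_y`. -/
noncomputable def probFA {K m : ℕ} (σ Ω : Fin K → ℝ) (a : Word K m) (θ : ℝ) : ℝ :=
  (outputLaw m σ Ω).real {b | θ ≤ logLikelihood σ Ω a b}

/-- Neyman-Pearson missed detection probability `P[Λ(a, y) < θ]`, `y ∼ p_{y|x}(· | a)`. -/
noncomputable def probMD {K m : ℕ} (σ Ω : Fin K → ℝ) (a : Word K m) (θ : ℝ) : ℝ :=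
  (channelLaw σ a).real {b | logLikelihood σ Ω a b < θ}

/-- Capacity, in bits per channel use. -/
noncomputable def capacity {K : ℕ} (Ω : Fin K → ℝ) : ℝ :=
  1 / (K : ℝ) * ∑ k, 1 / 2 * Real.logb 2 (1 + Ω k)

/-- The threshold on `Λ` that corresponds to the parameter `lam` of the exponents `α`, `β`.
One has `Λ = 1/2 + ln 2 * C - Λ' / (2 n)` with `Λ'` a weighted sum of (non-central) chi-squared
variables, and `lam` is the threshold on `Λ' / n`. -/
noncomputable def threshold {K : ℕ} (Ω : Fin K → ℝ) (lam : ℝ) : ℝ :=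
  1 / 2 + Real.log 2 * capacity Ω - lam / 2

/-- The exponent `α(s)`. -/
noncomputable def α {K : ℕ} (Ω : Fin K → ℝ) (lam s : ℝ) : ℝ :=
  2 * lam * s - 1 / (K : ℝ) * ∑ k,
    (2 * s * (1 + Ω k) / (1 + 2 * s * Ω k) + Real.log (1 + 2 * s * Ω k))

/-- The exponent `β(s)`. -/
noncomputable def β {K : ℕ} (Ω : Fin K → ℝ) (lam s : ℝ) : ℝ :=
  α Ω lam (s + 1 / 2) + 2 * Real.log 2 * capacity Ω + 1 - lam

/-- Real part of the region of convergence. -/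
def region {K : ℕ} (Ω : Fin K → ℝ) : Set ℝ :=
  {s | ∀ k, -(1 / (2 * Ω k)) < s}

/-- `s` is the saddle point `s_α`, i.e. the minimizer of `α` over the real region of
convergence. -/
def IsSaddlePoint {K : ℕ} (Ω : Fin K → ℝ) (lam s : ℝ) : Prop :=
  s ∈ region Ω ∧ IsMinOn (α Ω lam) (region Ω) s

/-- The coefficients `a_j` (`j ≥ 2`) of the Taylor expansion of `α` at `sα`. -/
noncomputable def taylorCoeff {K : ℕ} (Ω : Fin K → ℝ) (sα : ℝ) (j : ℕ) : ℝ :=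
  1 / (K : ℝ) * ∑ k,
    (((1 + Ω k) / Ω k) / (1 + 2 * sα * Ω k) + 1 / (j : ℝ))
      * (-2 * Ω k / (1 + 2 * sα * Ω k)) ^ j

/-- The second order correction `g(s)`; the coefficients `a_j` are those at `sα`. -/
noncomputable def g {K : ℕ} (Ω : Fin K → ℝ) (sα s : ℝ) : ℝ :=
  (12 * taylorCoeff Ω sα 2 * taylorCoeff Ω sα 4 - 15 * taylorCoeff Ω sα 3 ^ 2)
      / (8 * taylorCoeff Ω sα 2 ^ 3)
    - 3 * taylorCoeff Ω sα 3 / (2 * taylorCoeff Ω sα 2 ^ 2 * s)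
    - 1 / (taylorCoeff Ω sα 2 * s ^ 2)

/-- First-term approximation of `(1 / n) ln P_FA` (with `e = α(s_α)`, `s = s_α`) and of
`(1 / n) ln P_MD` (with `e = β(s_β)`, `s = s_β`). -/
noncomputable def approx₁ {K : ℕ} (Ω : Fin K → ℝ) (sα e s n : ℝ) : ℝ :=
  1 / 2 * e - 1 / (2 * n) * Real.log (2 * Real.pi * n * taylorCoeff Ω sα 2 * s ^ 2)

/-- Second-term approximation, with the same conventions. -/
noncomputable def approx₂ {K : ℕ} (Ω : Fin K → ℝ) (sα e s n : ℝ) : ℝ :=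
  approx₁ Ω sα e s n + 1 / n * Real.log (1 + 1 / n * g Ω sα s)

end ParallelAWGN

/-! Completing the square in each block gives `channelPDF = outputPDF * exp (n θ + S / 2)`, where
`S` is the `score`, so that `Λ = θ + S / (2 n)` and the two error events are `S ≥ 0` and `S < 0`.
Let `μ` be the law of `S` under the output density tilted by `exp (sα S)`, without normalization.
Undoing the tilt, `P_FA` is the integral of `exp (-sα x)` over `x ≥ 0` against `μ`, and `P_MD` is
`exp (n θ)` times the integral of `exp (-sβ x)` over `x < 0`. One tilt serves both because `sβ = sα
- 1/2`.

The characteristic function of `μ` at `t` is `exp (n α(sα + i t) / 2)` (`charFun_tiltedScoreLaw`):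
each block is a Gaussian integral, and the codeword enters it only through `‖a k‖ ^ 2`, which the
energy constraint fixes. This is the source of the uniformity in `a`. Fourier inversion on a half
line (`integral_Ici_exp_neg_eq`, `integral_Iio_exp_neg_eq`) then expresses both probabilities
through the integral of `exp (n κ(t)) / (1 + i t / c)`, with `κ(t) = (α(sα + i t) - α(sα)) / 2` and
`c = sα` or `c = sβ`.

At the saddle point `κ` has no linear term, and `κ(t) = -a₂ t² / 2 - i a₃ t³ / 2 + a₄ t⁴ / 2 +
O(|t|⁵)`, with real part accurate to `O(t⁶)`. On the scale `t ~ n ^ (-1/2)` the real part of the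
integrand is a Gaussian times a polynomial correction (`edgeworth`), up to a relative error of order
`n ^ (-2)`; away from `0` it is exponentially small. The second, fourth and sixth Gaussian moments
of the correction sum to `g / n` (`integral_exp_mul_edgeworth`), and
`abs_integral_saddleIntegrand_sub_le` bounds the rest. Taking logarithms and dividing by `n` turns
the relative error into `O(n ^ (-3))`. -/

namespace ParallelAWGN

/-! ### Elementary inequalities for `log`, `arctan`, `cos` and `exp`. -/

theorem nonneg_of_hasDerivAt_nonneg {f f' : ℝ → ℝ} (h0 : f 0 = 0)
    (hf : ∀ x, 0 ≤ x → HasDerivAt f (f' x) x) (hf' : ∀ x, 0 ≤ x → 0 ≤ f' x) {x : ℝ}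
    (hx : 0 ≤ x) : 0 ≤ f x := by
  have hm : MonotoneOn f (Set.Ici 0) := by
    apply monotoneOn_of_deriv_nonneg (convex_Ici 0)
    · exact fun y hy => (hf y hy).continuousAt.continuousWithinAt
    · intro y hy
      rw [interior_Ici] at hy
      exact (hf y (le_of_lt hy)).differentiableAt.differentiableWithinAt
    · intro y hy
      rw [interior_Ici] at hy
      rw [(hf y (le_of_lt hy)).deriv]
      exact hf' y (le_of_lt hy)
  simpa [h0] using hm (Set.mem_Ici.2 le_rfl) (Set.mem_Ici.2 hx) hx

/-- The difference of the two sides vanishes at `0` and has derivative `q ^ 2 / (1 + q)`. The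
one-sided `log` and `arctan` bounds that follow come from the same monotonicity argument, each with
an explicit nonnegative derivative. -/
theorem le_log_one_add {q : ℝ} (hq : 0 ≤ q) : q - q ^ 2 / 2 ≤ Real.log (1 + q) := by
  have := nonneg_of_hasDerivAt_nonneg (f := fun q => Real.log (1 + q) - q + q ^ 2 / 2)
    (f' := fun q => q ^ 2 / (1 + q)) (by simp) (fun x hx => by
      have h1 : (1 + x) ≠ 0 := by positivity
      have := ((((hasDerivAt_id x).const_add 1).log h1).sub (hasDerivAt_id x)).add
        (((hasDerivAt_id x).pow 2).div_const 2)
      refine this.congr_deriv ?_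
      simp
      field_simp
      ring) (fun x hx => by positivity) hq
  linarith

theorem log_one_add_le {q : ℝ} (hq : 0 ≤ q) : Real.log (1 + q) ≤ q - q ^ 2 / 2 + q ^ 3 / 3 := by
  have := nonneg_of_hasDerivAt_nonneg (f := fun q => q - q ^ 2 / 2 + q ^ 3 / 3 - Real.log (1 + q))
    (f' := fun q => q ^ 3 / (1 + q)) (by simp) (fun x hx => by
      have h1 : (1 + x) ≠ 0 := by positivity
      have := (((hasDerivAt_id x).sub (((hasDerivAt_id x).pow 2).div_const 2)).add
        (((hasDerivAt_id x).pow 3).div_const 3)).sub (((hasDerivAt_id x).const_add 1).log h1)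
      refine this.congr_deriv ?_
      simp
      field_simp
      ring) (fun x hx => by positivity) hq
  linarith

theorem abs_log_one_add_sub_le {q : ℝ} (hq : 0 ≤ q) :
    |Real.log (1 + q) - (q - q ^ 2 / 2)| ≤ q ^ 3 := by
  have := le_log_one_add hq
  have := log_one_add_le hq
  have : 0 ≤ q ^ 3 := by positivity
  rw [abs_le]; constructor <;> linarith

theorem abs_log_one_add_sub_self_le {q : ℝ} (hq : 0 ≤ q) :
    |Real.log (1 + q) - q| ≤ q ^ 2 := by
  have := le_log_one_add hq
  have := Real.log_le_sub_one_of_pos (show 0 < 1 + q by positivity)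
  have : 0 ≤ q ^ 2 := by positivity
  rw [abs_le]; constructor <;> linarith

theorem arctan_le {x : ℝ} (hx : 0 ≤ x) : Real.arctan x ≤ x - x ^ 3 / 3 + x ^ 5 / 5 := by
  have := nonneg_of_hasDerivAt_nonneg (f := fun q => q - q ^ 3 / 3 + q ^ 5 / 5 - Real.arctan q)
    (f' := fun q => q ^ 6 / (1 + q ^ 2)) (by simp) (fun x hx => by
      have h1 : (1 + x ^ 2) ≠ 0 := by positivity
      have := (((hasDerivAt_id x).sub (((hasDerivAt_id x).pow 3).div_const 3)).add
        (((hasDerivAt_id x).pow 5).div_const 5)).sub (Real.hasDerivAt_arctan x)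
      refine this.congr_deriv ?_
      simp
      field_simp
      ring) (fun x hx => by positivity) hx
  linarith

theorem le_arctan {x : ℝ} (hx : 0 ≤ x) : x - x ^ 3 / 3 ≤ Real.arctan x := by
  have := nonneg_of_hasDerivAt_nonneg (f := fun q => Real.arctan q - (q - q ^ 3 / 3))
    (f' := fun q => q ^ 4 / (1 + q ^ 2)) (by simp) (fun x hx => by
      have h1 : (1 + x ^ 2) ≠ 0 := by positivity
      have := (Real.hasDerivAt_arctan x).sub
        ((hasDerivAt_id x).sub (((hasDerivAt_id x).pow 3).div_const 3))
      refine this.congr_deriv ?_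
      simp
      field_simp
      ring) (fun x hx => by positivity) hx
  linarith

theorem arctan_le_self {x : ℝ} (hx : 0 ≤ x) : Real.arctan x ≤ x := by
  have := nonneg_of_hasDerivAt_nonneg (f := fun q => q - Real.arctan q)
    (f' := fun q => q ^ 2 / (1 + q ^ 2)) (by simp) (fun x hx => by
      have h1 : (1 + x ^ 2) ≠ 0 := by positivity
      have := (hasDerivAt_id x).sub (Real.hasDerivAt_arctan x)
      refine this.congr_deriv ?_
      field_simp
      ring) (fun x hx => by positivity) hx
  linarith

theorem abs_arctan_sub_le (x : ℝ) : |Real.arctan x - (x - x ^ 3 / 3)| ≤ |x| ^ 5 := by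
  wlog hx : 0 ≤ x generalizing x
  · have := this (-x) (by linarith)
    rw [Real.arctan_neg, abs_neg] at this
    rw [← abs_neg]
    convert this using 2
    ring
  rw [abs_of_nonneg hx]
  have := arctan_le hx
  have := le_arctan hx
  have : 0 ≤ x ^ 5 := by positivity
  rw [abs_le]; constructor <;> linarith

theorem abs_arctan_sub_self_le (x : ℝ) : |Real.arctan x - x| ≤ |x| ^ 3 := by
  wlog hx : 0 ≤ x generalizing x
  · have := this (-x) (by linarith)
    rw [Real.arctan_neg, abs_neg] at this
    rw [← abs_neg]
    convert this using 2
    ring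
  rw [abs_of_nonneg hx]
  have := arctan_le_self hx
  have := le_arctan hx
  have : 0 ≤ x ^ 3 := by positivity
  rw [abs_le]; constructor <;> linarith

/-- For `|y| ≤ 1` this is Taylor's bound; for `|y| > 1` the trivial `cos y ≤ 1` suffices, since then
`y ^ 2 ≤ y ^ 4`. A bound for all `y` is wanted because the phase `n J t` need not be small. -/
theorem abs_cos_sub_le (y : ℝ) : |Real.cos y - (1 - y ^ 2 / 2)| ≤ 3 * y ^ 4 := by
  have h1 := Real.one_sub_sq_div_two_le_cos (x := y)
  have h4 : 0 ≤ y ^ 4 := by positivity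
  rw [abs_of_nonneg (by linarith)]
  by_cases hy : |y| ≤ 1
  · have := (abs_le.1 (Real.cos_bound hy)).2
    have h : |y| ^ 4 = y ^ 4 := by rw [← abs_pow, abs_of_nonneg h4]
    rw [h] at this
    linarith
  · have h2 : 1 ≤ y ^ 2 := by
      rw [← sq_abs]; nlinarith
    have := Real.cos_le_one y
    nlinarith

/-- Replacing `exp x * cos y` by a second order polynomial in approximations `p`, `q` of `x`, `y`. -/
theorem abs_exp_mul_cos_sub_le (x y p q : ℝ) :
    |Real.exp x * Real.cos y - (1 + p - q ^ 2 / 2)| ≤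
      x ^ 2 * Real.exp |x| + 3 * (1 + |x|) * y ^ 4 + |x| * y ^ 2 + |x - p|
        + |y - q| * (|y| + |q|) := by
  have he : |Real.exp x - 1 - x| ≤ x ^ 2 * Real.exp |x| := by
    have := Complex.norm_exp_sub_sum_le_norm_mul_exp x 2
    have e : Complex.exp x - ∑ m ∈ Finset.range 2, (x : ℂ) ^ m / m.factorial
        = ((Real.exp x - 1 - x : ℝ) : ℂ) := by
      simp [Finset.sum_range_succ, sub_sub]
    rw [e, Complex.norm_real, Complex.norm_real, Real.norm_eq_abs, Real.norm_eq_abs, sq_abs] at this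
    exact this
  -- One summand for each source of error: the remainders of `exp` and of `cos`, the neglected cross
  -- term, and the replacement of `x` by `p` and of `y` by `q`.
  have e : Real.exp x * Real.cos y - (1 + p - q ^ 2 / 2) =
      (Real.exp x - 1 - x) * Real.cos y + (1 + x) * (Real.cos y - (1 - y ^ 2 / 2))
        + (- (x * y ^ 2 / 2)) + (x - p) + (-((y - q) * (y + q) / 2)) := by ring
  rw [e]
  refine (abs_add_le _ _).trans (add_le_add ((abs_add_le _ _).trans (add_le_add
    ((abs_add_le _ _).trans (add_le_add ((abs_add_le _ _).trans (add_le_add ?_ ?_)) ?_)) le_rfl)) ?_)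
  · rw [abs_mul]
    calc _ ≤ |Real.exp x - 1 - x| * 1 := by gcongr; exact Real.abs_cos_le_one y
      _ ≤ _ := by linarith
  · rw [abs_mul]
    calc _ ≤ (1 + |x|) * (3 * y ^ 4) := by
          gcongr
          · simpa using abs_add_le 1 x
          · exact abs_cos_sub_le y
      _ = _ := by ring
  · rw [abs_neg, abs_div, abs_mul, abs_of_nonneg (sq_nonneg y), abs_two]
    have : 0 ≤ |x| * y ^ 2 := by positivity
    linarith
  · rw [abs_neg, abs_div, abs_mul, abs_two]
    have : |y - q| * |y + q| ≤ |y - q| * (|y| + |q|) := by gcongr; exact abs_add_le _ _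
    have : 0 ≤ |y - q| * |y + q| := by positivity
    linarith

/-! ### Gaussian moments. -/

theorem integrable_pow_mul_exp {b : ℝ} (hb : 0 < b) (j : ℕ) :
    Integrable fun t : ℝ => t ^ j * Real.exp (-b * t ^ 2) := by
  have := integrable_rpow_mul_exp_neg_mul_sq hb (s := j) (by
    have : (0 : ℝ) ≤ j := by positivity
    linarith)
  simpa using this

/-- Even Gaussian moments by integration by parts. -/
theorem integral_pow_add_two_mul_exp {b : ℝ} (hb : 0 < b) (k : ℕ) :
    ∫ t : ℝ, t ^ (k + 2) * Real.exp (-b * t ^ 2)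
      = (k + 1) / (2 * b) * ∫ t : ℝ, t ^ k * Real.exp (-b * t ^ 2) := by
  have hi (j : ℕ) := integrable_pow_mul_exp hb j
  have hd : ∀ t : ℝ, HasDerivAt (fun t => t ^ (k + 1) * Real.exp (-b * t ^ 2))
      ((k + 1) * (t ^ k * Real.exp (-b * t ^ 2)) - 2 * b * (t ^ (k + 2) * Real.exp (-b * t ^ 2)))
      t := by
    intro t
    have := (hasDerivAt_pow (k + 1) t).mul (((hasDerivAt_pow 2 t).const_mul (-b)).exp)
    refine this.congr_deriv ?_
    push_cast
    simp
    ring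
  have := integral_eq_zero_of_hasDerivAt_of_integrable hd
    (((hi k).const_mul _).sub ((hi (k + 2)).const_mul _)) (hi (k + 1))
  rw [integral_sub ((hi k).const_mul _) ((hi (k + 2)).const_mul _), integral_const_mul,
    integral_const_mul] at this
  rw [div_mul_eq_mul_div, eq_div_iff (by positivity)]
  linarith

theorem integral_pow_two_mul_exp {b : ℝ} (hb : 0 < b) :
    ∫ t : ℝ, t ^ 2 * Real.exp (-b * t ^ 2) = 1 / (2 * b) * √(Real.pi / b) := by
  have := integral_pow_add_two_mul_exp hb 0
  simp only [pow_zero, one_mul, integral_gaussian] at this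
  simpa using this

theorem integral_pow_four_mul_exp {b : ℝ} (hb : 0 < b) :
    ∫ t : ℝ, t ^ 4 * Real.exp (-b * t ^ 2) = 3 / (4 * b ^ 2) * √(Real.pi / b) := by
  have := integral_pow_add_two_mul_exp hb 2
  rw [integral_pow_two_mul_exp hb] at this
  rw [this]; push_cast; field_simp; norm_num

theorem integral_pow_six_mul_exp {b : ℝ} (hb : 0 < b) :
    ∫ t : ℝ, t ^ 6 * Real.exp (-b * t ^ 2) = 15 / (8 * b ^ 3) * √(Real.pi / b) := by
  have := integral_pow_add_two_mul_exp hb 4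
  rw [integral_pow_four_mul_exp hb] at this
  rw [this]; push_cast; field_simp; norm_num

/-! ### Laplace's method to second order. -/

theorem one_add_pow_le_exp {η : ℝ} (hη : 0 < η) :
    ∃ C, 0 ≤ C ∧ ∀ T : ℝ, 0 ≤ T → (1 + T) ^ 5 ≤ C * Real.exp (η * T) := by
  -- From `u ^ 5 / 5! ≤ exp u` at `u = η (1 + T)`; the shift by one costs the factor `exp η`.
  refine ⟨120 / η ^ 5 * Real.exp η, by positivity, fun T hT => ?_⟩
  have := Real.pow_div_factorial_le_exp (η * (1 + T)) (by positivity) 5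
  rw [mul_assoc, ← Real.exp_add, show η + η * T = η * (1 + T) by ring]
  simp only [Nat.factorial] at this
  rw [mul_pow] at this
  rw [div_mul_eq_mul_div, le_div_iff₀ (by positivity)]
  push_cast at this
  linarith

/-- The polynomial correction to the Gaussian in the saddle point expansion. -/
noncomputable def edgeworth (a3 a4 e n t : ℝ) : ℝ :=
  1 + (n * a4 * t ^ 4 / 2 - e ^ 2 * t ^ 2 / 2) - (-(n * a3 * t ^ 3 / 2) - e * t) ^ 2 / 2

/-- The real part of `exp (n κ(t)) / (1 + i e t)` where `κ = R + i J`. -/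
noncomputable def saddleIntegrand (R J : ℝ → ℝ) (e n t : ℝ) : ℝ :=
  Real.exp (n * R t - Real.log (1 + (e * t) ^ 2) / 2) * Real.cos (n * J t - Real.arctan (e * t))

/-- With `T = n t ^ 2` and `t ^ 2 ≤ T`, every monomial of the correction is at most a power `(1 + T)
^ j` with `j ≤ 3`. The exponent is raised to `5` so that `one_add_pow_le_exp` can absorb it. -/
theorem abs_edgeworth_le (a3 a4 e : ℝ) :
    ∃ C, 0 ≤ C ∧ ∀ n t : ℝ, 1 ≤ n → |edgeworth a3 a4 e n t| ≤ C * (1 + n * t ^ 2) ^ 5 := by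
  refine ⟨1 + |a4| + a3 ^ 2 + 2 * e ^ 2, by positivity, fun n t hn => ?_⟩
  have hT : 0 ≤ n * t ^ 2 := by positivity
  have h2 : t ^ 2 ≤ n * t ^ 2 := le_mul_of_one_le_left (by positivity) hn
  set T := n * t ^ 2 with hTdef
  have hU : 1 ≤ 1 + T := by linarith
  have hp (j : ℕ) (hj : j ≤ 5) : (1 + T) ^ j ≤ (1 + T) ^ 5 := pow_le_pow_right₀ hU hj
  have h1 : 1 ≤ (1 + T) ^ 5 := one_le_pow₀ hU
  have hT1 : t ^ 2 ≤ (1 + T) ^ 5 := by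
    have := hp 1 (by norm_num)
    linarith
  have hT2 : n * t ^ 4 ≤ (1 + T) ^ 5 := by
    have := hp 2 (by norm_num)
    have e1 : n * t ^ 4 = T * t ^ 2 := by rw [hTdef]; ring
    nlinarith
  have hT3 : n ^ 2 * t ^ 6 ≤ (1 + T) ^ 5 := by
    have := hp 3 (by norm_num)
    have e1 : n ^ 2 * t ^ 6 = T * T * t ^ 2 := by rw [hTdef]; ring
    have : T * T * t ^ 2 ≤ T * T * T := by gcongr
    nlinarith [mul_nonneg hT hT]
  have hb : (-(n * a3 * t ^ 3 / 2) - e * t) ^ 2 / 2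
      ≤ a3 ^ 2 * (n ^ 2 * t ^ 6) + e ^ 2 * t ^ 2 := by
    nlinarith [sq_nonneg (n * a3 * t ^ 3 / 2 - e * t), sq_nonneg (n * a3 * t ^ 3)]
  have hb0 : 0 ≤ (-(n * a3 * t ^ 3 / 2) - e * t) ^ 2 / 2 := by positivity
  have hc : |n * a4 * t ^ 4 / 2| ≤ |a4| * (n * t ^ 4) := by
    rw [show n * a4 * t ^ 4 / 2 = a4 * (n * t ^ 4) / 2 by ring, abs_div, abs_mul, abs_two,
      abs_of_nonneg (show 0 ≤ n * t ^ 4 by positivity)]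
    have : 0 ≤ |a4| * (n * t ^ 4) := by positivity
    linarith
  have hc' := abs_le.1 hc
  have g1 : |a4| * (n * t ^ 4) ≤ |a4| * (1 + T) ^ 5 := by gcongr
  have g2 : a3 ^ 2 * (n ^ 2 * t ^ 6) ≤ a3 ^ 2 * (1 + T) ^ 5 := by gcongr
  have g3 : e ^ 2 * t ^ 2 ≤ e ^ 2 * (1 + T) ^ 5 := by gcongr
  have g4 : 0 ≤ e ^ 2 * t ^ 2 := by positivity
  rw [edgeworth, abs_le]
  constructor <;> nlinarith

/-- Combination of the error terms of the local expansion. -/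
theorem abs_exp_mul_cos_sub_le_of_bounds {D t U x y p q : ℝ} (hD : 1 ≤ D) (ht : |t| ≤ 1)
    (hU : 1 ≤ U) (hx : |x| ≤ D * t ^ 2 * U) (hxp : |x - p| ≤ D * t ^ 4 * U)
    (hy : |y| ≤ D * |t| * U) (hyq : |y - q| ≤ D * |t| ^ 3 * U) (hq : |q| ≤ D * |t| * U) :
    |Real.exp x * Real.cos y - (1 + p - q ^ 2 / 2)| ≤
      11 * D ^ 5 * t ^ 4 * U ^ 5 * Real.exp |x| := by
  refine (abs_exp_mul_cos_sub_le x y p q).trans ?_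
  have h2 : t ^ 2 ≤ 1 := by rw [← sq_abs]; exact pow_le_one₀ (abs_nonneg t) ht
  have hE : 1 ≤ Real.exp |x| := Real.one_le_exp (abs_nonneg x)
  have hs : |t| ^ 2 = t ^ 2 := sq_abs t
  have hs4 : |t| ^ 4 = t ^ 4 := by rw [show |t| ^ 4 = (|t| ^ 2) ^ 2 by ring, hs]; ring
  have hD' (j : ℕ) (hj : j ≤ 5) : D ^ j ≤ D ^ 5 := pow_le_pow_right₀ hD hj
  have hU' (j : ℕ) (hj : j ≤ 5) : U ^ j ≤ U ^ 5 := pow_le_pow_right₀ hU hj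
  have hDU (j k : ℕ) (hj : j ≤ 5) (hk : k ≤ 5) :
      D ^ j * t ^ 4 * U ^ k ≤ D ^ 5 * t ^ 4 * U ^ 5 := by
    have := hD' j hj
    have := hU' k hk
    gcongr
  have h1 : x ^ 2 * Real.exp |x| ≤ D ^ 5 * t ^ 4 * U ^ 5 * Real.exp |x| := by
    gcongr
    calc x ^ 2 = |x| ^ 2 := (sq_abs x).symm
      _ ≤ (D * t ^ 2 * U) ^ 2 := by gcongr
      _ = D ^ 2 * t ^ 4 * U ^ 2 := by ring
      _ ≤ _ := hDU 2 2 (by norm_num) (by norm_num)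
  have hy4 : y ^ 4 ≤ D ^ 4 * t ^ 4 * U ^ 4 := by
    calc y ^ 4 = |y| ^ 4 := by rw [← abs_pow, abs_of_nonneg (by positivity)]
      _ ≤ (D * |t| * U) ^ 4 := by gcongr
      _ = D ^ 4 * |t| ^ 4 * U ^ 4 := by ring
      _ = _ := by rw [hs4]
  have hy2 : y ^ 2 ≤ D ^ 2 * t ^ 2 * U ^ 2 := by
    calc y ^ 2 = |y| ^ 2 := (sq_abs y).symm
      _ ≤ (D * |t| * U) ^ 2 := by gcongr
      _ = D ^ 2 * |t| ^ 2 * U ^ 2 := by ring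
      _ = _ := by rw [hs]
  have hDU1 : 1 ≤ D * U := one_le_mul_of_one_le_of_one_le hD hU
  have hx1 : 1 + |x| ≤ 2 * (D * U) := by
    have : D * t ^ 2 * U ≤ D * 1 * U := by gcongr
    linarith
  have h3 : 3 * (1 + |x|) * y ^ 4 ≤ 6 * (D ^ 5 * t ^ 4 * U ^ 5) := by
    calc 3 * (1 + |x|) * y ^ 4 ≤ 3 * (2 * (D * U)) * (D ^ 4 * t ^ 4 * U ^ 4) := by gcongr
      _ = _ := by ring
  have h4 : |x| * y ^ 2 ≤ D ^ 5 * t ^ 4 * U ^ 5 := by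
    calc |x| * y ^ 2 ≤ (D * t ^ 2 * U) * (D ^ 2 * t ^ 2 * U ^ 2) := by gcongr
      _ = D ^ 3 * t ^ 4 * U ^ 3 := by ring
      _ ≤ _ := hDU 3 3 (by norm_num) (by norm_num)
  have h5 : |x - p| ≤ D ^ 5 * t ^ 4 * U ^ 5 := by
    refine hxp.trans ?_
    simpa using hDU 1 1 (by norm_num) (by norm_num)
  have h6 : |y - q| * (|y| + |q|) ≤ 2 * (D ^ 5 * t ^ 4 * U ^ 5) := by
    calc |y - q| * (|y| + |q|) ≤ (D * |t| ^ 3 * U) * (D * |t| * U + D * |t| * U) := by gcongr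
      _ = 2 * (D ^ 2 * |t| ^ 4 * U ^ 2) := by ring
      _ ≤ _ := by
        rw [hs4]
        have := hDU 2 2 (by norm_num) (by norm_num)
        linarith
  have hZ : 0 ≤ D ^ 5 * t ^ 4 * U ^ 5 := by positivity
  -- The five error terms contribute `1 + 6 + 1 + 1 + 2 = 11`; those without the factor `exp |x|`
  -- are enlarged by it.
  have h7 : D ^ 5 * t ^ 4 * U ^ 5 ≤ D ^ 5 * t ^ 4 * U ^ 5 * Real.exp |x| :=
    le_mul_of_one_le_right hZ hE
  nlinarith

/-- The exponent of the modulus of the integrand, compared with its polynomial approximation. -/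
theorem abs_log_modulus_sub_le {R : ℝ → ℝ} {a2 a4 C : ℝ} (e : ℝ) (hC : 0 ≤ C)
    (hR : ∀ t, |R t - (-(a2 * t ^ 2 / 2) + a4 * t ^ 4 / 2)| ≤ C * t ^ 6) :
    ∃ D, 1 ≤ D ∧ ∀ n t : ℝ, 1 ≤ n → |t| ≤ 1 →
      |n * R t - Real.log (1 + (e * t) ^ 2) / 2 + a2 * n * t ^ 2 / 2|
        ≤ D * t ^ 2 * (1 + n * t ^ 2) ∧
      |n * R t - Real.log (1 + (e * t) ^ 2) / 2 + a2 * n * t ^ 2 / 2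
        - (n * a4 * t ^ 4 / 2 - e ^ 2 * t ^ 2 / 2)| ≤ D * t ^ 4 * (1 + n * t ^ 2) := by
  refine ⟨1 + C + |a4| + e ^ 2 + e ^ 4, ?_, fun n t hn ht => ?_⟩
  · have : 0 ≤ C + |a4| + e ^ 2 + e ^ 4 := by positivity
    linarith
  have h2 : t ^ 2 ≤ 1 := by rw [← sq_abs]; exact pow_le_one₀ (abs_nonneg t) ht
  set T := n * t ^ 2 with hTdef
  have hT : 0 ≤ T := by positivity
  set x := n * R t - Real.log (1 + (e * t) ^ 2) / 2 + a2 * n * t ^ 2 / 2 with hxdef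
  set p := n * a4 * t ^ 4 / 2 - e ^ 2 * t ^ 2 / 2 with hpdef
  have hxp : |x - p| ≤ (C + e ^ 4) * t ^ 4 * (1 + T) := by
    have e1 : x - p = n * (R t - (-(a2 * t ^ 2 / 2) + a4 * t ^ 4 / 2))
        + -((Real.log (1 + (e * t) ^ 2) - (e * t) ^ 2) / 2) := by
      rw [hxdef, hpdef]; ring
    have b1 : |n * (R t - (-(a2 * t ^ 2 / 2) + a4 * t ^ 4 / 2))| ≤ C * t ^ 4 * T := by
      rw [abs_mul, abs_of_nonneg (by linarith)]
      calc _ ≤ n * (C * t ^ 6) := by gcongr; exact hR t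
        _ = _ := by rw [hTdef]; ring
    have b2 : |-((Real.log (1 + (e * t) ^ 2) - (e * t) ^ 2) / 2)| ≤ e ^ 4 * t ^ 4 := by
      rw [abs_neg, abs_div, abs_two]
      have := abs_log_one_add_sub_self_le (sq_nonneg (e * t))
      have e2 : ((e * t) ^ 2) ^ 2 = e ^ 4 * t ^ 4 := by ring
      have : 0 ≤ e ^ 4 * t ^ 4 := by positivity
      linarith
    rw [e1]
    refine (abs_add_le _ _).trans ((add_le_add b1 b2).trans ?_)
    have : 0 ≤ e ^ 4 * t ^ 4 * T := by positivity
    have : 0 ≤ C * t ^ 4 := by positivity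
    linarith
  have hp : |p| ≤ (|a4| + e ^ 2) * t ^ 2 * (1 + T) := by
    have b1 : |n * a4 * t ^ 4 / 2| ≤ |a4| * t ^ 2 * T := by
      rw [show n * a4 * t ^ 4 / 2 = a4 * (t ^ 2 * T) / 2 by rw [hTdef]; ring, abs_div, abs_mul,
        abs_two, abs_of_nonneg (show 0 ≤ t ^ 2 * T by positivity)]
      have : 0 ≤ |a4| * (t ^ 2 * T) := by positivity
      linarith
    have b2 : |e ^ 2 * t ^ 2 / 2| ≤ e ^ 2 * t ^ 2 := by
      rw [abs_of_nonneg (by positivity)]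
      have : 0 ≤ e ^ 2 * t ^ 2 := by positivity
      linarith
    refine (abs_sub _ _).trans ((add_le_add b1 b2).trans ?_)
    have : 0 ≤ e ^ 2 * t ^ 2 * T := by positivity
    have : 0 ≤ |a4| * t ^ 2 := by positivity
    linarith
  have h4 : (C + e ^ 4) * t ^ 4 * (1 + T) ≤ (C + e ^ 4) * t ^ 2 * (1 + T) := by
    have : t ^ 4 ≤ t ^ 2 := by nlinarith [sq_nonneg t]
    gcongr
  have h5 : 0 ≤ (1 + |a4| + e ^ 2) * t ^ 4 * (1 + T) := by positivity
  have h6 : 0 ≤ t ^ 2 * (1 + T) := by positivity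
  constructor
  · have := abs_add_le (x - p) p
    rw [sub_add_cancel] at this
    linarith
  · linarith

/-- The argument of the integrand, compared with its polynomial approximation. -/
theorem abs_phase_sub_le {J : ℝ → ℝ} {a3 C : ℝ} (e : ℝ) (hC : 0 ≤ C)
    (hJ : ∀ t, |J t + a3 * t ^ 3 / 2| ≤ C * |t| ^ 5) :
    ∃ D, 1 ≤ D ∧ ∀ n t : ℝ, 1 ≤ n → |t| ≤ 1 →
      |n * J t - Real.arctan (e * t)| ≤ D * |t| * (1 + n * t ^ 2) ∧
      |n * J t - Real.arctan (e * t) - (-(n * a3 * t ^ 3 / 2) - e * t)|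
        ≤ D * |t| ^ 3 * (1 + n * t ^ 2) ∧
      |-(n * a3 * t ^ 3 / 2) - e * t| ≤ D * |t| * (1 + n * t ^ 2) := by
  refine ⟨1 + C + |a3| + |e| + |e| ^ 3, ?_, fun n t hn ht => ?_⟩
  · have : 0 ≤ C + |a3| + |e| + |e| ^ 3 := by positivity
    linarith
  set T := n * t ^ 2 with hTdef
  have hT : 0 ≤ T := by positivity
  have hs : |t| ^ 2 = t ^ 2 := sq_abs t
  set y := n * J t - Real.arctan (e * t) with hydef
  set q := -(n * a3 * t ^ 3 / 2) - e * t with hqdef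
  have hyq : |y - q| ≤ (C + |e| ^ 3) * |t| ^ 3 * (1 + T) := by
    have e1 : y - q = n * (J t + a3 * t ^ 3 / 2) + -(Real.arctan (e * t) - e * t) := by
      rw [hydef, hqdef]; ring
    have b1 : |n * (J t + a3 * t ^ 3 / 2)| ≤ C * |t| ^ 3 * T := by
      rw [abs_mul, abs_of_nonneg (by linarith)]
      calc _ ≤ n * (C * |t| ^ 5) := by gcongr; exact hJ t
        _ = _ := by rw [hTdef, ← hs]; ring
    have b2 : |-(Real.arctan (e * t) - e * t)| ≤ |e| ^ 3 * |t| ^ 3 := by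
      rw [abs_neg, ← mul_pow, ← abs_mul]
      exact abs_arctan_sub_self_le _
    rw [e1]
    refine (abs_add_le _ _).trans ((add_le_add b1 b2).trans ?_)
    have : 0 ≤ |e| ^ 3 * |t| ^ 3 * T := by positivity
    have : 0 ≤ C * |t| ^ 3 := by positivity
    linarith
  have hq : |q| ≤ (|a3| + |e|) * |t| * (1 + T) := by
    have b1 : |-(n * a3 * t ^ 3 / 2)| ≤ |a3| * |t| * T := by
      rw [abs_neg, show n * a3 * t ^ 3 / 2 = a3 * t * T / 2 by rw [hTdef]; ring, abs_div, abs_mul,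
        abs_mul, abs_two, abs_of_nonneg hT]
      have : 0 ≤ |a3| * |t| * T := by positivity
      linarith
    refine (abs_sub _ _).trans ((add_le_add b1 (abs_mul e t).le).trans ?_)
    have : 0 ≤ |e| * |t| * T := by positivity
    have : 0 ≤ |a3| * |t| := by positivity
    linarith
  have h3 : (C + |e| ^ 3) * |t| ^ 3 * (1 + T) ≤ (C + |e| ^ 3) * |t| * (1 + T) := by
    have : |t| ^ 3 ≤ |t| := pow_le_of_le_one (abs_nonneg t) ht (by norm_num)
    gcongr
  have h5 : 0 ≤ (1 + |a3| + |e|) * |t| ^ 3 * (1 + T) := by positivity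
  have h6 : 0 ≤ |t| * (1 + T) := by positivity
  have h7 : 0 ≤ (1 + C + |e| ^ 3) * |t| * (1 + T) := by positivity
  refine ⟨?_, by linarith, by linarith⟩
  have := abs_add_le (y - q) q
  rw [sub_add_cancel] at this
  linarith

/-- Local Gaussian approximation of the saddle point integrand. -/
theorem abs_saddleIntegrand_sub_le {R J : ℝ → ℝ} {a2 a3 a4 C : ℝ} (e : ℝ) (ha2 : 0 < a2)
    (hC : 0 ≤ C) (hR : ∀ t, |R t - (-(a2 * t ^ 2 / 2) + a4 * t ^ 4 / 2)| ≤ C * t ^ 6)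
    (hJ : ∀ t, |J t + a3 * t ^ 3 / 2| ≤ C * |t| ^ 5) :
    ∃ δ B, 0 < δ ∧ 0 ≤ B ∧ ∀ n t : ℝ, 1 ≤ n → |t| ≤ δ →
      |saddleIntegrand R J e n t - Real.exp (-(a2 / 2 * n) * t ^ 2) * edgeworth a3 a4 e n t|
        ≤ B * (t ^ 4 * Real.exp (-(a2 / 8 * n) * t ^ 2)) := by
  obtain ⟨C0, hC0, hexp⟩ := one_add_pow_le_exp (η := a2 / 8) (by positivity)
  obtain ⟨D1, hD1, hx⟩ := abs_log_modulus_sub_le e hC hR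
  obtain ⟨D2, hD2, hy⟩ := abs_phase_sub_le e hC hJ
  set D := max D1 D2 with hDdef
  have hD : 1 ≤ D := hD1.trans (le_max_left _ _)
  -- For `|t| ≤ δ` one has `D t ^ 2 ≤ a2 / 4`, hence `|x| ≤ D + (a2 / 4) T`. The Gaussian rate `a2 /
  -- 2` pays `a2 / 4` for `exp |x|` and `a2 / 8` for the factor `(1 + T) ^ 5`, which leaves `a2 /
  -- 8`.
  refine ⟨min 1 √(a2 / (4 * D)), 11 * D ^ 5 * (C0 * Real.exp D), by positivity,
    by positivity, fun n t hn ht => ?_⟩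
  have ht1 : |t| ≤ 1 := ht.trans (min_le_left _ _)
  have ht2 : t ^ 2 ≤ a2 / (4 * D) := by
    have := ht.trans (min_le_right _ _)
    rw [← sq_abs, ← Real.sq_sqrt (show 0 ≤ a2 / (4 * D) by positivity)]
    gcongr
  have h2 : t ^ 2 ≤ 1 := by rw [← sq_abs]; exact pow_le_one₀ (abs_nonneg t) ht1
  obtain ⟨hx1, hxp⟩ := hx n t hn ht1
  obtain ⟨hy1, hyq, hq⟩ := hy n t hn ht1
  set T := n * t ^ 2 with hTdef
  have hT : 0 ≤ T := by positivity
  set x := n * R t - Real.log (1 + (e * t) ^ 2) / 2 + a2 * n * t ^ 2 / 2 with hxdef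
  set y := n * J t - Real.arctan (e * t) with hydef
  set p := n * a4 * t ^ 4 / 2 - e ^ 2 * t ^ 2 / 2 with hpdef
  set q := -(n * a3 * t ^ 3 / 2) - e * t with hqdef
  have hl : D1 ≤ D := le_max_left _ _
  have hr : D2 ≤ D := le_max_right _ _
  have hx1 : |x| ≤ D * t ^ 2 * (1 + T) := hx1.trans (by gcongr)
  have key := abs_exp_mul_cos_sub_le_of_bounds hD ht1 (show 1 ≤ 1 + T by linarith) hx1
    (hxp.trans (by gcongr)) (hy1.trans (by gcongr)) (hyq.trans (by gcongr))
    (hq.trans (by gcongr))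
  have hsplit : saddleIntegrand R J e n t
      - Real.exp (-(a2 / 2 * n) * t ^ 2) * edgeworth a3 a4 e n t
      = Real.exp (-(a2 / 2 * n) * t ^ 2)
        * (Real.exp x * Real.cos y - (1 + p - q ^ 2 / 2)) := by
    rw [mul_sub, ← mul_assoc, ← Real.exp_add, saddleIntegrand, edgeworth]
    congr 4
    rw [hxdef]; ring
  rw [hsplit, abs_mul, Real.abs_exp]
  have hxe : |x| ≤ D + a2 / 4 * T := by
    have : D * t ^ 2 ≤ a2 / 4 := by
      calc D * t ^ 2 ≤ D * (a2 / (4 * D)) := by gcongr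
        _ = a2 / 4 := by field_simp
    have h3 : D * t ^ 2 * T ≤ a2 / 4 * T := by gcongr
    have h4 : D * t ^ 2 ≤ D * 1 := by gcongr
    linarith
  calc Real.exp (-(a2 / 2 * n) * t ^ 2) * |Real.exp x * Real.cos y - (1 + p - q ^ 2 / 2)|
      ≤ Real.exp (-(a2 / 2 * n) * t ^ 2) *
        (11 * D ^ 5 * t ^ 4 * (1 + T) ^ 5 * Real.exp |x|) := by gcongr
    _ ≤ Real.exp (-(a2 / 2 * n) * t ^ 2) * (11 * D ^ 5 * t ^ 4
        * (C0 * Real.exp (a2 / 8 * T)) * Real.exp (D + a2 / 4 * T)) := by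
        gcongr
        exact hexp T hT
    _ = 11 * D ^ 5 * C0 * t ^ 4 * (Real.exp (-(a2 / 2 * n) * t ^ 2)
        * Real.exp (a2 / 8 * T) * Real.exp (D + a2 / 4 * T)) := by ring
    _ = 11 * D ^ 5 * C0 * t ^ 4 *
        (Real.exp D * Real.exp (-(a2 / 8 * n) * t ^ 2)) := by
        rw [← Real.exp_add, ← Real.exp_add, ← Real.exp_add]
        congr 2
        rw [hTdef]; ring
    _ = _ := by ring

/-- Under the normalized Gaussian weight the moments of `t ^ 2`, `t ^ 4`, `t ^ 6` are `1 / (a2 n)`,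
`3 / (a2 n) ^ 2`, `15 / (a2 n) ^ 3`, so all terms of the correction have order `1 / n`. The `e ^ 2`
terms from the modulus and from the squared phase each contribute half of `-e ^ 2 / a2`. -/
theorem integral_exp_mul_edgeworth {a2 : ℝ} (a3 a4 e : ℝ) {n : ℝ} (ha2 : 0 < a2) (hn : 0 < n) :
    Integrable (fun t => Real.exp (-(a2 / 2 * n) * t ^ 2) * edgeworth a3 a4 e n t) ∧
    ∫ t, Real.exp (-(a2 / 2 * n) * t ^ 2) * edgeworth a3 a4 e n t =
      √(Real.pi / (a2 / 2 * n)) * (1 + ((12 * a2 * a4 - 15 * a3 ^ 2) / (8 * a2 ^ 3)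
        - 3 * a3 / (2 * a2 ^ 2) * e - e ^ 2 / a2) / n) := by
  have hb : 0 < a2 / 2 * n := by positivity
  have hi (j : ℕ) := integrable_pow_mul_exp hb j
  set b := a2 / 2 * n with hbdef
  have h0 : Integrable fun t : ℝ => Real.exp (-b * t ^ 2) := integrable_exp_neg_mul_sq hb
  have he : (fun t => Real.exp (-b * t ^ 2) * edgeworth a3 a4 e n t) = fun t =>
      Real.exp (-b * t ^ 2) + (-e ^ 2) * (t ^ 2 * Real.exp (-b * t ^ 2))
        + (n * a4 / 2 - n * a3 * e / 2) * (t ^ 4 * Real.exp (-b * t ^ 2))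
        + (-(n ^ 2 * a3 ^ 2 / 8)) * (t ^ 6 * Real.exp (-b * t ^ 2)) := by
    funext t
    rw [edgeworth]; ring
  have i1 : Integrable fun t : ℝ =>
      Real.exp (-b * t ^ 2) + (-e ^ 2) * (t ^ 2 * Real.exp (-b * t ^ 2)) :=
    h0.add ((hi 2).const_mul (-e ^ 2))
  have i2 : Integrable fun t : ℝ =>
      Real.exp (-b * t ^ 2) + (-e ^ 2) * (t ^ 2 * Real.exp (-b * t ^ 2))
        + (n * a4 / 2 - n * a3 * e / 2) * (t ^ 4 * Real.exp (-b * t ^ 2)) :=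
    i1.add ((hi 4).const_mul (n * a4 / 2 - n * a3 * e / 2))
  have i3 := i2.add ((hi 6).const_mul (-(n ^ 2 * a3 ^ 2 / 8)))
  rw [he]
  refine ⟨i3, ?_⟩
  rw [integral_add i2 ((hi 6).const_mul _), integral_add i1 ((hi 4).const_mul _),
    integral_add h0 ((hi 2).const_mul _), integral_const_mul, integral_const_mul,
    integral_const_mul, integral_gaussian, integral_pow_two_mul_exp hb,
    integral_pow_four_mul_exp hb, integral_pow_six_mul_exp hb, hbdef]
  field_simp
  ring

theorem exp_neg_mul_le {l n : ℝ} (hl : 0 < l) (hn : 0 < n) :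
    Real.exp (-(n * l)) ≤ 6 / l ^ 3 / n ^ 3 := by
  have := Real.pow_div_factorial_le_exp (n * l) (by positivity) 3
  simp only [Nat.factorial] at this
  push_cast at this
  rw [Real.exp_neg, div_div, ← one_div, div_le_div_iff₀ (Real.exp_pos _) (by positivity)]
  rw [mul_pow, div_le_iff₀ (by norm_num)] at this
  linarith

/-- The integrand is dominated by an integrable function and exponentially small away from `0`. -/
theorem abs_saddleIntegrand_le {R : ℝ → ℝ} {w : ℝ} (J : ℝ → ℝ) (e : ℝ)
    (hdecay : ∀ t, R t ≤ -(Real.log (1 + (w * t) ^ 2) / 4)) {n : ℝ} (hn : 4 ≤ n) (t : ℝ) :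
    |saddleIntegrand R J e n t| ≤
      Real.exp (-((n / 4 - 1) * Real.log (1 + (w * t) ^ 2))) * (1 + (w * t) ^ 2)⁻¹ := by
  have h0 : 0 < 1 + (w * t) ^ 2 := by positivity
  have hl : 0 ≤ Real.log (1 + (e * t) ^ 2) :=
    Real.log_nonneg (by linarith [sq_nonneg (e * t)])
  rw [saddleIntegrand, abs_mul, Real.abs_exp]
  calc _ ≤ Real.exp (n * R t - Real.log (1 + (e * t) ^ 2) / 2) * 1 := by
        gcongr; exact Real.abs_cos_le_one _
    _ ≤ Real.exp (-((n / 4 - 1) * Real.log (1 + (w * t) ^ 2)) - Real.log (1 + (w * t) ^ 2)) := by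
        rw [mul_one, Real.exp_le_exp]
        have := mul_le_mul_of_nonneg_left (hdecay t) (show 0 ≤ n by linarith)
        linarith
    _ = _ := by rw [sub_eq_add_neg, Real.exp_add, Real.exp_neg (Real.log _), Real.exp_log h0]

/-- Near `0` this is the local estimate. For `|t| > δ` no cancellation is needed: the integrand and
its approximation are each small, and the two terms of the majorant receive them separately. -/
theorem abs_saddleIntegrand_sub_le_global {R J : ℝ → ℝ} {a2 a3 a4 C w : ℝ} (e : ℝ) (ha2 : 0 < a2)
    (hw : 0 < w) (hC : 0 ≤ C)
    (hR : ∀ t, |R t - (-(a2 * t ^ 2 / 2) + a4 * t ^ 4 / 2)| ≤ C * t ^ 6)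
    (hJ : ∀ t, |J t + a3 * t ^ 3 / 2| ≤ C * |t| ^ 5)
    (hdecay : ∀ t, R t ≤ -(Real.log (1 + (w * t) ^ 2) / 4)) :
    ∃ B, 0 ≤ B ∧ ∀ n t : ℝ, 4 ≤ n →
      |saddleIntegrand R J e n t - Real.exp (-(a2 / 2 * n) * t ^ 2) * edgeworth a3 a4 e n t|
        ≤ B * (t ^ 4 * Real.exp (-(a2 / 8 * n) * t ^ 2)) + B / n ^ 3 * (1 + (w * t) ^ 2)⁻¹ := by
  obtain ⟨δ, B1, hδ, hB1, hloc⟩ := abs_saddleIntegrand_sub_le e ha2 hC hR hJ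
  obtain ⟨C0, hC0, hexp⟩ := one_add_pow_le_exp (η := a2 / 8) (by positivity)
  obtain ⟨C1, hC1, hed⟩ := abs_edgeworth_le a3 a4 e
  set l := Real.log (1 + (w * δ) ^ 2) with hldef
  have hl : 0 < l := Real.log_pos (by
    have : 0 < (w * δ) ^ 2 := by positivity
    linarith)
  have hB2 : 0 ≤ C1 * C0 / δ ^ 4 := by positivity
  have hB3 : 0 ≤ Real.exp l * (6 / (l / 4) ^ 3) := by positivity
  refine ⟨B1 + C1 * C0 / δ ^ 4 + Real.exp l * (6 / (l / 4) ^ 3), by positivity,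
    fun n t hn => ?_⟩
  have hn0 : 0 < n := by linarith
  set E := t ^ 4 * Real.exp (-(a2 / 8 * n) * t ^ 2) with hEdef
  have hE : 0 ≤ E := by positivity
  set I := (1 + (w * t) ^ 2)⁻¹ with hIdef
  have hI : 0 ≤ I := by positivity
  by_cases ht : |t| ≤ δ
  · refine (hloc n t (by linarith) ht).trans ?_
    have : 0 ≤ (B1 + C1 * C0 / δ ^ 4 + Real.exp l * (6 / (l / 4) ^ 3)) / n ^ 3 * I := by positivity
    have : 0 ≤ (C1 * C0 / δ ^ 4 + Real.exp l * (6 / (l / 4) ^ 3)) * E := by positivity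
    linarith
  push Not at ht
  have ht2 : δ ^ 2 ≤ t ^ 2 := by rw [← sq_abs t]; gcongr
  have b1 : |saddleIntegrand R J e n t| ≤ Real.exp l * (6 / (l / 4) ^ 3) / n ^ 3 * I := by
    refine (abs_saddleIntegrand_le J e hdecay hn t).trans ?_
    gcongr
    have hll : l ≤ Real.log (1 + (w * t) ^ 2) := by
      rw [hldef]
      apply Real.log_le_log (by positivity)
      rw [mul_pow, mul_pow]
      gcongr
    calc Real.exp (-((n / 4 - 1) * Real.log (1 + (w * t) ^ 2)))
        ≤ Real.exp (-((n / 4 - 1) * l)) := by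
          gcongr
          linarith
      -- The factor `exp l` pays for the `-1` in `n / 4 - 1`, that is, for the power of `1 + (w t) ^
      -- 2` reserved for integrability.
      _ = Real.exp l * Real.exp (-(n * (l / 4))) := by
          rw [← Real.exp_add]; congr 1; ring
      _ ≤ Real.exp l * (6 / (l / 4) ^ 3 / n ^ 3) := by
          gcongr
          exact exp_neg_mul_le (by positivity) hn0
      _ = _ := by ring
  have b2 : |Real.exp (-(a2 / 2 * n) * t ^ 2) * edgeworth a3 a4 e n t| ≤ C1 * C0 / δ ^ 4 * E := by
    rw [abs_mul, Real.abs_exp]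
    have hT : 0 ≤ n * t ^ 2 := by positivity
    calc _ ≤ Real.exp (-(a2 / 2 * n) * t ^ 2) * (C1 * (C0 * Real.exp (a2 / 8 * (n * t ^ 2)))) := by
          gcongr
          exact (hed n t (by linarith)).trans (by gcongr; exact hexp _ hT)
      _ = C1 * C0 * Real.exp (-(a2 / 2 * n) * t ^ 2 + a2 / 8 * (n * t ^ 2)) := by
          rw [Real.exp_add]; ring
      _ ≤ C1 * C0 * Real.exp (-(a2 / 8 * n) * t ^ 2) := by
          gcongr
          have := mul_nonneg ha2.le hT
          linarith
      -- Since `t ^ 4 / δ ^ 4 ≥ 1` here, the Gaussian tail fits under the majorant of the local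
      -- error.
      _ ≤ C1 * C0 * Real.exp (-(a2 / 8 * n) * t ^ 2) * (t ^ 4 / δ ^ 4) := by
          apply le_mul_of_one_le_right (by positivity)
          rw [one_le_div (by positivity)]
          calc δ ^ 4 = (δ ^ 2) ^ 2 := by ring
            _ ≤ (t ^ 2) ^ 2 := by gcongr
            _ = t ^ 4 := by ring
      _ = _ := by rw [hEdef]; ring
  refine (abs_sub _ _).trans ((add_le_add b1 b2).trans ?_)
  have e1 : 0 ≤ (B1 + C1 * C0 / δ ^ 4) / n ^ 3 * I := by positivity
  have e2 : 0 ≤ (B1 + Real.exp l * (6 / (l / 4) ^ 3)) * E := by positivity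
  calc _ ≤ Real.exp l * (6 / (l / 4) ^ 3) / n ^ 3 * I + C1 * C0 / δ ^ 4 * E
        + (B1 + C1 * C0 / δ ^ 4) / n ^ 3 * I + (B1 + Real.exp l * (6 / (l / 4) ^ 3)) * E := by
        linarith
    _ = _ := by ring

/-- **Laplace's method to second order** for `exp (n κ(t)) / (1 + i e t)`. -/
theorem abs_integral_saddleIntegrand_sub_le {R J : ℝ → ℝ} {a2 a3 a4 C w : ℝ} (e : ℝ)
    (ha2 : 0 < a2) (hw : 0 < w) (hC : 0 ≤ C) (hRc : Continuous R) (hJc : Continuous J)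
    (hR : ∀ t, |R t - (-(a2 * t ^ 2 / 2) + a4 * t ^ 4 / 2)| ≤ C * t ^ 6)
    (hJ : ∀ t, |J t + a3 * t ^ 3 / 2| ≤ C * |t| ^ 5)
    (hdecay : ∀ t, R t ≤ -(Real.log (1 + (w * t) ^ 2) / 4)) :
    ∃ B, 0 ≤ B ∧ ∀ n : ℝ, 4 ≤ n →
      |(∫ t, saddleIntegrand R J e n t) - √(Real.pi / (a2 / 2 * n))
        * (1 + ((12 * a2 * a4 - 15 * a3 ^ 2) / (8 * a2 ^ 3)
        - 3 * a3 / (2 * a2 ^ 2) * e - e ^ 2 / a2) / n)| ≤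
      √(Real.pi / (a2 / 2 * n)) * (B / n ^ 2) := by
  obtain ⟨B, hB, hbd⟩ := abs_saddleIntegrand_sub_le_global e ha2 hw hC hR hJ hdecay
  -- The first term is the fourth moment at rate `a2 / 8`, with `2 = √4` converting its Gaussian
  -- mass to the one at rate `a2 / 2`. The second is the mass `π / w` of the Cauchy tail, whose
  -- factor `n ^ (-3)` is at most `n ^ (-1/2) * n ^ (-2)`.
  refine ⟨B * (3 / (4 * (a2 / 8) ^ 2) * 2) + B * (Real.pi / w) / √(Real.pi / (a2 / 2)),
    by positivity, fun n hn => ?_⟩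
  have hn0 : 0 < n := by linarith
  obtain ⟨hmi, hme⟩ := integral_exp_mul_edgeworth a3 a4 e ha2 hn0
  have hb : 0 < a2 / 8 * n := by positivity
  have i1 := (integrable_pow_mul_exp hb 4).const_mul B
  have i2 : Integrable fun t : ℝ => B / n ^ 3 * (1 + (w * t) ^ 2)⁻¹ :=
    (integrable_inv_one_add_sq.comp_mul_left' hw.ne').const_mul _
  have hFm : Continuous (saddleIntegrand R J e n) := by
    unfold saddleIntegrand
    have : ∀ t : ℝ, 1 + (e * t) ^ 2 ≠ 0 := fun t => by positivity
    fun_prop (disch := assumption)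
  have hd : Integrable fun t => saddleIntegrand R J e n t
      - Real.exp (-(a2 / 2 * n) * t ^ 2) * edgeworth a3 a4 e n t :=
    (i1.add i2).mono' (hFm.aestronglyMeasurable.sub hmi.aestronglyMeasurable)
      (Filter.Eventually.of_forall fun t => hbd n t hn)
  have hF : Integrable (saddleIntegrand R J e n) := by
    refine (hd.add hmi).congr (Filter.Eventually.of_forall fun t => ?_)
    simp
  rw [← hme, ← integral_sub hF hmi]
  have := norm_integral_le_of_norm_le (μ := volume)
    (f := fun t => saddleIntegrand R J e n t
      - Real.exp (-(a2 / 2 * n) * t ^ 2) * edgeworth a3 a4 e n t) (i1.add i2) (Filter.Eventually.of_forall fun t => hbd n t hn)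
  rw [Real.norm_eq_abs] at this
  have hI : ∫ t : ℝ, (1 + (w * t) ^ 2)⁻¹ = Real.pi / w := by
    rw [Measure.integral_comp_mul_left (fun t : ℝ => (1 + t ^ 2)⁻¹) w,
      integral_univ_inv_one_add_sq, abs_of_pos (by positivity), smul_eq_mul]
    field_simp
  have e1 : ∫ t : ℝ, (B * (t ^ 4 * Real.exp (-(a2 / 8 * n) * t ^ 2))
      + B / n ^ 3 * (1 + (w * t) ^ 2)⁻¹)
      = B * (3 / (4 * (a2 / 8 * n) ^ 2) * √(Real.pi / (a2 / 8 * n)))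
        + B / n ^ 3 * (Real.pi / w) := by
    rw [integral_add i1 i2, integral_const_mul, integral_const_mul, hI,
      integral_pow_four_mul_exp hb]
  refine this.trans (le_of_eq_of_le e1 ?_)
  have e2 : √(Real.pi / (a2 / 8 * n)) = 2 * √(Real.pi / (a2 / 2 * n)) := by
    rw [show Real.pi / (a2 / 8 * n) = 2 ^ 2 * (Real.pi / (a2 / 2 * n)) by field_simp; norm_num,
      Real.sqrt_mul (by norm_num), Real.sqrt_sq (by norm_num)]
  have e3 : √(Real.pi / (a2 / 2 * n)) = √(Real.pi / (a2 / 2)) / √n := by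
    rw [← Real.sqrt_div' _ hn0.le]; congr 1; field_simp
  have hs : √n ≤ n := by
    rw [Real.sqrt_le_left hn0.le]; nlinarith
  have hsn : 0 < √n := Real.sqrt_pos.2 hn0
  have e4 : B / n ^ 3 * (Real.pi / w) ≤
      √(Real.pi / (a2 / 2 * n)) * (B * (Real.pi / w) / √(Real.pi / (a2 / 2)) / n ^ 2) := by
    have hp : 0 < √(Real.pi / (a2 / 2)) := by positivity
    rw [e3]
    calc B / n ^ 3 * (Real.pi / w) = B * (Real.pi / w) / n ^ 2 * (1 / n) := by field_simp
      _ ≤ B * (Real.pi / w) / n ^ 2 * (1 / √n) := by gcongr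
      _ = _ := by field_simp
  rw [add_div, mul_add, e2]
  refine add_le_add (le_of_eq ?_) e4
  field_simp

/-! ### Fourier inversion on half lines. -/

open Complex in
/-- Parseval's formula for a finite measure and a function with integrable Fourier transform. -/
theorem integral_eq_integral_mul_charFun {μ : Measure ℝ} [IsFiniteMeasure μ] {ψ h : ℝ → ℂ}
    (hψc : Continuous ψ) (hψ : Integrable ψ) (hh : Integrable h)
    (hF : ∀ t : ℝ, ∫ x : ℝ, cexp (-(t * x * I)) * ψ x = h t) :
    ∫ x, ψ x ∂μ = 1 / (2 * Real.pi) * ∫ t, h t * charFun μ t := by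
  have h2π : (2 * Real.pi : ℝ) ≠ 0 := by positivity
  -- Passage from the kernel `exp (-i t x)` to the normalization with `2π` in the exponent.
  have hft : FourierTransform.fourier ψ = fun ξ : ℝ => h (2 * Real.pi * ξ) := by
    funext ξ
    rw [Real.fourier_real_eq_integral_exp_smul, ← hF]
    congr 1
    funext x
    rw [smul_eq_mul]
    congr 2
    push_cast
    ring
  have hinv (x : ℝ) : ψ x = 1 / (2 * Real.pi) * ∫ t : ℝ, cexp (t * x * I) * h t := by
    have h1 := congrFun (hψc.fourierInv_fourier_eq hψ (by
      rw [hft]; exact hh.comp_mul_left' h2π)) x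
    rw [← h1, hft, Real.fourierInv_eq']
    have h3 := Measure.integral_comp_mul_left (fun t : ℝ => cexp (t * x * I) * h t) (2 * Real.pi)
    rw [abs_of_pos (by positivity)] at h3
    have h4 : ((2 * Real.pi)⁻¹ : ℝ) • ∫ t : ℝ, cexp (t * x * I) * h t
        = 1 / (2 * Real.pi) * ∫ t : ℝ, cexp (t * x * I) * h t := by
      rw [Complex.real_smul]; push_cast; ring
    rw [← h4, ← h3]
    congr 1
    funext v
    rw [smul_eq_mul]
    congr 2
    simp
    ring
  -- Fubini applies because `μ` is finite, `h` is integrable and the kernel has modulus one.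
  have hint : Integrable (Function.uncurry fun (x t : ℝ) => cexp (t * x * I) * h t)
      (μ.prod volume) := by
    have : Integrable (fun z : ℝ × ℝ => h z.2) (μ.prod volume) := hh.comp_snd μ
    refine this.mono ?_ (Filter.Eventually.of_forall fun z => ?_)
    · refine AEStronglyMeasurable.mul ?_ this.aestronglyMeasurable
      exact Continuous.aestronglyMeasurable (by fun_prop)
    · have : ‖cexp (z.2 * z.1 * I)‖ = 1 := by
        rw [← ofReal_mul]; exact norm_exp_ofReal_mul_I _
      simp [Function.uncurry, this]
  calc ∫ x, ψ x ∂μ = ∫ x : ℝ, (1 / (2 * Real.pi) * ∫ t : ℝ, cexp (t * x * I) * h t) ∂μ :=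
        integral_congr_ae (Filter.Eventually.of_forall hinv)
    _ = 1 / (2 * Real.pi) * ∫ t : ℝ, ∫ x : ℝ, cexp (t * x * I) * h t ∂μ := by
        rw [integral_const_mul, integral_integral_swap hint]
    _ = _ := by
        congr 2
        funext t
        rw [integral_mul_const, charFun_apply_real, mul_comm]

open Complex in
/-- A finite measure with integrable characteristic function does not charge the origin. -/
theorem measure_singleton_zero_of_integrable_charFun {μ : Measure ℝ} [IsFiniteMeasure μ]
    (hφ : Integrable (charFun μ)) : μ {0} = 0 := by
  -- The Gaussian `exp (-r x ^ 2)` equals `1` at the origin, while its transform is bounded by `√(π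
  -- / r)`, which tends to `0` as `r → ∞`.
  have hbound (r : ℝ) (hr : 0 < r) : μ.real {0} ≤
      1 / (2 * Real.pi) * √(Real.pi / r) * ∫ t, ‖charFun μ t‖ := by
    have hr' : 0 < (r : ℂ).re := by simpa
    have hP := integral_eq_integral_mul_charFun (μ := μ)
      (ψ := fun x => cexp (-r * x ^ 2))
      (h := fun t => (Real.pi / r : ℂ) ^ (1 / 2 : ℂ) * cexp (-t ^ 2 / (4 * r)))
      (by fun_prop) (integrable_cexp_neg_mul_sq hr')
      (by
        have := (integrable_cexp_neg_mul_sq (b := (1 / (4 * r) : ℂ)) (by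
          have : (1 / (4 * r) : ℂ) = ((1 / (4 * r) : ℝ) : ℂ) := by push_cast; rfl
          rw [this, ofReal_re]; positivity)).const_mul ((Real.pi / r : ℂ) ^ (1 / 2 : ℂ))
        convert this using 5
        ring)
      (fun t => by
        have := fourierIntegral_gaussian hr' (-t)
        simp only [neg_sq] at this
        rw [← this]
        refine integral_congr_ae (Filter.Eventually.of_forall fun x => ?_)
        change cexp _ * cexp _ = _
        congr 2
        ring)
    have hsq : ((Real.pi / r : ℂ) ^ (1 / 2 : ℂ)) = (√(Real.pi / r) : ℝ) := by
      rw [Real.sqrt_eq_rpow, ofReal_cpow (by positivity)]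
      push_cast; rfl
    have hreal : ∫ x : ℝ, cexp (-r * x ^ 2) ∂μ = ((∫ x, Real.exp (-r * x ^ 2) ∂μ : ℝ) : ℂ) := by
      rw [← integral_complex_ofReal]
      congr 1
      funext x
      push_cast
      rfl
    have hint : Integrable (fun x => Real.exp (-r * x ^ 2)) μ := by
      refine Integrable.of_bound (C := 1) (by fun_prop) (Filter.Eventually.of_forall fun x => ?_)
      rw [Real.norm_eq_abs, Real.abs_exp, Real.exp_le_one_iff]
      nlinarith [sq_nonneg x]
    have hle : μ.real {0} ≤ ∫ x, Real.exp (-r * x ^ 2) ∂μ := by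
      have := setIntegral_le_integral (s := {0}) hint
        (Filter.Eventually.of_forall fun x => (Real.exp_pos _).le)
      rw [integral_singleton] at this
      simpa using this
    refine hle.trans ?_
    have hn : ∫ x, Real.exp (-r * x ^ 2) ∂μ ≤ ‖∫ x : ℝ, cexp (-r * x ^ 2) ∂μ‖ := by
      rw [hreal, norm_real]; exact le_abs_self _
    refine hn.trans ?_
    rw [hP, norm_mul, mul_assoc]
    have e1 : ‖(1 / (2 * Real.pi) : ℂ)‖ = 1 / (2 * Real.pi) := by
      rw [show (1 / (2 * Real.pi) : ℂ) = ((1 / (2 * Real.pi) : ℝ) : ℂ) by push_cast; rfl, norm_real,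
        Real.norm_eq_abs, abs_of_pos (by positivity)]
    rw [e1, ← integral_const_mul]
    gcongr
    refine norm_integral_le_of_norm_le (hφ.norm.const_mul _)
      (Filter.Eventually.of_forall fun t => ?_)
    rw [norm_mul, norm_mul, hsq, norm_real, Real.norm_eq_abs, abs_of_nonneg (Real.sqrt_nonneg _)]
    have : ‖cexp (-t ^ 2 / (4 * r))‖ ≤ 1 := by
      rw [show (-t ^ 2 / (4 * r) : ℂ) = ((-t ^ 2 / (4 * r) : ℝ) : ℂ) by push_cast; rfl,
        norm_exp_ofReal, Real.exp_le_one_iff]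
      apply div_nonpos_of_nonpos_of_nonneg
      · nlinarith [sq_nonneg t]
      · positivity
    have h1 : √(Real.pi / r) * ‖cexp (-t ^ 2 / (4 * r))‖ ≤ √(Real.pi / r) * 1 := by gcongr
    rw [mul_one] at h1
    gcongr
  have hlim : Filter.Tendsto (fun r : ℝ => 1 / (2 * Real.pi) * √(Real.pi / r)
      * ∫ t, ‖charFun μ t‖) Filter.atTop (nhds 0) := by
    have h1 : Filter.Tendsto (fun r : ℝ => √(Real.pi / r)) Filter.atTop (nhds 0) := by
      have := (Filter.Tendsto.const_div_atTop Filter.tendsto_id Real.pi).sqrt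
      simpa using this
    simpa using (h1.const_mul (1 / (2 * Real.pi))).mul_const (∫ t, ‖charFun μ t‖)
  have h0 : μ.real {0} ≤ 0 := ge_of_tendsto hlim (by
    filter_upwards [Filter.eventually_gt_atTop 0] with r hr using hbound r hr)
  have := le_antisymm h0 measureReal_nonneg
  exact (measureReal_eq_zero_iff (measure_ne_top _ _)).1 this

-- The function `exp (-c x)` on `x > 0` jumps at `0` and its transform `1 / (c + i t)` is not
-- integrable. Subtracting a faster exponential makes the function continuous and the transform of
-- order `t ^ (-2)`, so Parseval applies; `R → ∞` then recovers the jump.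
open Complex in
theorem integral_exp_neg_max_sub {c R : ℝ} (hc : 0 < c) (hR : 0 ≤ R) :
    Integrable (fun x : ℝ => ((Real.exp (-(c * max x 0))
      - Real.exp (-((c + R) * max x 0)) : ℝ) : ℂ)) ∧
    ∀ t : ℝ, ∫ x : ℝ, cexp (-(t * x * I)) * ((Real.exp (-(c * max x 0))
      - Real.exp (-((c + R) * max x 0)) : ℝ) : ℂ) = 1 / (c + t * I) - 1 / (c + R + t * I) := by
  have hcR : 0 < c + R := by linarith
  set ψ : ℝ → ℂ := fun x => ((Real.exp (-(c * max x 0))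
      - Real.exp (-((c + R) * max x 0)) : ℝ) : ℂ) with hψ
  have hsupp : ∀ x, x ∉ Set.Ioi (0 : ℝ) → ψ x = 0 := by
    intro x hx
    have : max x 0 = 0 := max_eq_right (by simpa using hx)
    simp [hψ, this]
  have hon (t x : ℝ) (hx : x ∈ Set.Ioi (0 : ℝ)) : cexp (-(t * x * I)) * ψ x =
      cexp (-(c + t * I) * x) - cexp (-(c + R + t * I) * x) := by
    have : max x 0 = x := max_eq_left (le_of_lt hx)
    simp only [hψ, this]
    push_cast
    rw [mul_sub, ← Complex.exp_add, ← Complex.exp_add]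
    congr 2 <;> ring
  have hre (t : ℝ) : (-(c + t * I)).re < 0 := by simp [hc]
  have hre' (t : ℝ) : (-(c + R + t * I)).re < 0 := by simp; linarith
  have hi1 (t : ℝ) := integrableOn_exp_mul_complex_Ioi (hre t) 0
  have hi2 (t : ℝ) := integrableOn_exp_mul_complex_Ioi (hre' t) 0
  constructor
  · have h1 : IntegrableOn ψ (Set.Ioi 0) := by
      refine ((hi1 0).sub (hi2 0)).congr_fun (fun x hx => ?_) measurableSet_Ioi
      have := hon 0 x hx
      simp only [ofReal_zero, zero_mul, neg_zero, Complex.exp_zero, one_mul] at this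
      simp only [Pi.sub_apply, ofReal_zero, zero_mul]
      exact this.symm
    refine (integrableOn_iff_integrable_of_support_subset ?_).1 h1
    intro x hx
    by_contra h
    exact hx (hsupp x h)
  · intro t
    change ∫ x : ℝ, cexp (-(t * x * I)) * ψ x = _
    rw [← setIntegral_eq_integral_of_forall_compl_eq_zero (s := Set.Ioi 0)
      (fun x hx => by rw [hsupp x hx, mul_zero]),
      setIntegral_congr_fun measurableSet_Ioi (fun x hx => hon t x hx),
      integral_sub (hi1 t) (hi2 t), integral_exp_mul_complex_Ioi (hre t),
      integral_exp_mul_complex_Ioi (hre' t)]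
    simp only [ofReal_zero, mul_zero, Complex.exp_zero, neg_div_neg_eq]

open Complex in
theorem norm_one_div_add_mul_I_le {c : ℝ} (hc : 0 < c) (t : ℝ) : ‖1 / (c + t * I)‖ ≤ 1 / c := by
  rw [norm_div, norm_one]
  gcongr
  have := Complex.abs_re_le_norm (c + t * I)
  simp at this
  exact (le_abs_self c).trans this

open Complex in
theorem integrable_one_div_sub_one_div {c R : ℝ} (hc : 0 < c) (hR : 0 ≤ R) :
    Integrable fun t : ℝ => 1 / (c + t * I) - 1 / (c + R + t * I : ℂ) := by
  have hcR : 0 < c + R := by linarith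
  have hre (t : ℝ) : (c + t * I : ℂ) ≠ 0 := fun h => by
    have := congrArg Complex.re h
    simp at this; linarith
  have hre' (t : ℝ) : (c + R + t * I : ℂ) ≠ 0 := fun h => by
    have := congrArg Complex.re h
    simp at this; linarith
  refine ((integrable_inv_one_add_sq.comp_mul_left' (inv_ne_zero hc.ne')).const_mul
    (R / c ^ 2)).mono' (Continuous.aestronglyMeasurable (by fun_prop (disch := simp [hre, hre'])))
    (Filter.Eventually.of_forall fun t => ?_)
  have e1 : 1 / (c + t * I) - 1 / (c + R + t * I : ℂ) = R / ((c + t * I) * (c + R + t * I)) := by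
    have := hre t; have := hre' t
    field_simp
    ring
  have n1 : c ^ 2 + t ^ 2 ≤ ‖(c + t * I : ℂ)‖ * ‖(c + R + t * I : ℂ)‖ := by
    have h1 : ‖(c + t * I : ℂ)‖ = √(c ^ 2 + t ^ 2) := Complex.norm_add_mul_I c t
    have h2 : ‖(c + R + t * I : ℂ)‖ = √((c + R) ^ 2 + t ^ 2) := by
      rw [← Complex.norm_add_mul_I]; push_cast; rfl
    rw [h1, h2]
    calc c ^ 2 + t ^ 2 = √(c ^ 2 + t ^ 2) * √(c ^ 2 + t ^ 2) :=
          (Real.mul_self_sqrt (by positivity)).symm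
      _ ≤ _ := by gcongr; linarith
  rw [e1, norm_div, norm_mul, norm_real, Real.norm_eq_abs, abs_of_nonneg hR]
  calc R / (‖(c + t * I : ℂ)‖ * ‖(c + R + t * I : ℂ)‖) ≤ R / (c ^ 2 + t ^ 2) := by gcongr
    _ = _ := by field_simp

open Complex in
/-- The one-sided Laplace transform of a measure in terms of its characteristic function. -/
theorem integral_Ioi_exp_neg_eq {μ : Measure ℝ} [IsFiniteMeasure μ] (hφ : Integrable (charFun μ))
    {c : ℝ} (hc : 0 < c) :
    ((∫ x in Set.Ioi 0, Real.exp (-(c * x)) ∂μ : ℝ) : ℂ)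
      = 1 / (2 * Real.pi) * ∫ t : ℝ, 1 / (c + t * I) * charFun μ t := by
  have hP (m : ℕ) := integral_eq_integral_mul_charFun (μ := μ) (by fun_prop)
    (integral_exp_neg_max_sub hc (Nat.cast_nonneg m)).1
    (integrable_one_div_sub_one_div hc (Nat.cast_nonneg m))
    (integral_exp_neg_max_sub hc (Nat.cast_nonneg m)).2
  -- The approximants all vanish at `x = 0`, so the limit sees the open half line only.
  have hL : Filter.Tendsto (fun m : ℕ => ∫ x : ℝ, ((Real.exp (-(c * max x 0))
      - Real.exp (-((c + m) * max x 0)) : ℝ) : ℂ) ∂μ) Filter.atTop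
      (nhds (∫ x, (((Set.Ioi 0).indicator (fun x => Real.exp (-(c * x))) x : ℝ) : ℂ) ∂μ)) := by
    refine tendsto_integral_of_dominated_convergence (fun _ => (1 : ℝ))
      (fun m => Continuous.aestronglyMeasurable (by fun_prop)) (integrable_const _)
      (fun m => Filter.Eventually.of_forall fun x => ?_)
      (Filter.Eventually.of_forall fun x => ?_)
    · rw [norm_real, Real.norm_eq_abs, abs_le]
      have hm : 0 ≤ max x 0 := le_max_right _ _
      have h1 : Real.exp (-(c * max x 0)) ≤ 1 := by
        rw [Real.exp_le_one_iff]; have := mul_nonneg hc.le hm; linarith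
      have h2 : Real.exp (-((c + m) * max x 0)) ≤ 1 := by
        rw [Real.exp_le_one_iff]
        have := mul_nonneg (show 0 ≤ c + m by positivity) hm; linarith
      constructor <;> linarith [Real.exp_pos (-(c * max x 0)), Real.exp_pos (-((c + m) * max x 0))]
    · refine (Complex.continuous_ofReal.tendsto _).comp ?_
      by_cases hx : 0 < x
      · rw [Set.indicator_of_mem (Set.mem_Ioi.2 hx), max_eq_left hx.le]
        have h3 : Filter.Tendsto (fun m : ℕ => Real.exp (-((c + m) * x))) Filter.atTop (nhds 0) := by
          refine Real.tendsto_exp_neg_atTop_nhds_zero.comp ?_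
          exact (Filter.tendsto_atTop_add_const_left _ c tendsto_natCast_atTop_atTop).atTop_mul_const
            hx
        simpa using h3.const_sub (Real.exp (-(c * x)))
      · rw [Set.indicator_of_notMem (show x ∉ Set.Ioi 0 from hx), max_eq_right (not_lt.1 hx)]
        simp
  -- Both kernels are bounded by `1 / c`, so the integrable characteristic function supplies the
  -- domination.
  have hRlim : Filter.Tendsto (fun m : ℕ => 1 / (2 * Real.pi : ℂ) *
      ∫ t : ℝ, (1 / (c + t * I) - 1 / (c + (m : ℝ) + t * I)) * charFun μ t) Filter.atTop
      (nhds (1 / (2 * Real.pi) * ∫ t : ℝ, 1 / (c + t * I) * charFun μ t)) := by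
    refine Filter.Tendsto.const_mul _ ?_
    refine tendsto_integral_of_dominated_convergence (fun t => (2 / c) * ‖charFun μ t‖)
      (fun m => ((integrable_one_div_sub_one_div hc (Nat.cast_nonneg m)).aestronglyMeasurable.mul
        hφ.aestronglyMeasurable)) (hφ.norm.const_mul _)
      (fun m => Filter.Eventually.of_forall fun t => ?_)
      (Filter.Eventually.of_forall fun t => ?_)
    · rw [norm_mul]
      gcongr
      refine (norm_sub_le _ _).trans ?_
      have h1 := norm_one_div_add_mul_I_le hc t
      have h2 := norm_one_div_add_mul_I_le (show 0 < c + (m : ℝ) by positivity) t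
      have h3 : 1 / (c + (m : ℝ)) ≤ 1 / c := by
        gcongr
        have : (0 : ℝ) ≤ m := Nat.cast_nonneg m
        linarith
      push_cast at h2 ⊢
      have : 2 / c = 1 / c + 1 / c := by ring
      linarith
    · refine Filter.Tendsto.mul_const _ ?_
      have : Filter.Tendsto (fun m : ℕ => 1 / (c + (m : ℝ) + t * I : ℂ)) Filter.atTop (nhds 0) := by
        rw [tendsto_zero_iff_norm_tendsto_zero]
        refine squeeze_zero (fun _ => norm_nonneg _) (g := fun m : ℕ => 1 / (c + (m : ℝ)))
          (fun m => ?_) ?_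
        · have h2 := norm_one_div_add_mul_I_le (show 0 < c + (m : ℝ) by positivity) t
          push_cast at h2 ⊢
          exact h2
        · exact (Filter.tendsto_atTop_add_const_left _ c
            tendsto_natCast_atTop_atTop).const_div_atTop 1
      simpa using this.const_sub (1 / (c + t * I : ℂ))
  have := tendsto_nhds_unique hL (hRlim.congr fun m => (hP m).symm)
  rw [← this, integral_complex_ofReal, integral_indicator measurableSet_Ioi]

open Complex in
/-- Real form of the inversion formula on the right half line. -/
theorem integral_Ici_exp_neg_eq {μ : Measure ℝ} [IsFiniteMeasure μ] (hφ : Integrable (charFun μ))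
    {c : ℝ} (hc : 0 < c) :
    ∫ x in Set.Ici 0, Real.exp (-(c * x)) ∂μ
      = 1 / (2 * Real.pi) * ∫ t : ℝ, (1 / (c + t * I) * charFun μ t).re := by
  -- The absence of an atom at `0` closes the half line.
  have hae : (Set.Ici (0 : ℝ) : Set ℝ) =ᵐ[μ] Set.Ioi 0 :=
    (Ioi_ae_eq_Ici' (measure_singleton_zero_of_integrable_charFun hφ)).symm
  have hi : Integrable fun t : ℝ => 1 / (c + t * I) * charFun μ t := by
    refine (hφ.norm.const_mul (1 / c)).mono' (AEStronglyMeasurable.mul ?_ hφ.aestronglyMeasurable)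
      (Filter.Eventually.of_forall fun t => ?_)
    · refine Continuous.aestronglyMeasurable ?_
      have hre (t : ℝ) : (c + t * I : ℂ) ≠ 0 := fun h => by
        have := congrArg Complex.re h
        simp at this; linarith
      fun_prop (disch := simp [hre])
    · rw [norm_mul]
      gcongr
      exact norm_one_div_add_mul_I_le hc t
  rw [setIntegral_congr_set hae]
  have h := congrArg Complex.re (integral_Ioi_exp_neg_eq hφ hc)
  rw [ofReal_re] at h
  rw [h, show (1 / (2 * Real.pi) : ℂ) = ((1 / (2 * Real.pi) : ℝ) : ℂ) by push_cast; rfl,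
    re_ofReal_mul]
  congr 1
  exact (integral_re hi).symm

open Complex in
/-- Real form of the inversion formula on the left half line. -/
theorem integral_Iio_exp_neg_eq {μ : Measure ℝ} [IsFiniteMeasure μ] (hφ : Integrable (charFun μ))
    {c : ℝ} (hc : c < 0) :
    ∫ x in Set.Iio 0, Real.exp (-(c * x)) ∂μ
      = -(1 / (2 * Real.pi) * ∫ t : ℝ, (1 / (c + t * I) * charFun μ t).re) := by
  -- The reflection `x ↦ -x` turns `c < 0` into `-c > 0` and conjugates the frequency, so the
  -- previous inversion formula applies.
  have hcf (t : ℝ) : charFun (μ.map (fun x => -1 * x)) t = charFun μ (-t) := by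
    rw [charFun_map_mul]; simp
  have hφ' : Integrable (charFun (μ.map (fun x => -1 * x))) := by
    refine (hφ.comp_neg).congr (Filter.Eventually.of_forall fun t => ?_)
    exact (hcf t).symm
  have hc' : 0 < -c := by linarith
  have hm : Measurable fun x : ℝ => -1 * x := by fun_prop
  have key := integral_Ici_exp_neg_eq hφ' hc'
  have h0 : (Set.Iio (0 : ℝ) : Set ℝ) =ᵐ[μ] Set.Iic 0 :=
    Iio_ae_eq_Iic' (measure_singleton_zero_of_integrable_charFun hφ)
  rw [setIntegral_congr_set h0]
  rw [setIntegral_map measurableSet_Ici (Continuous.aestronglyMeasurable (by fun_prop))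
    hm.aemeasurable] at key
  have hpre : (fun x : ℝ => -1 * x) ⁻¹' Set.Ici 0 = Set.Iic 0 := by ext x; simp
  rw [hpre] at key
  simp only [hcf] at key
  have e1 : ∫ x in Set.Iic 0, Real.exp (-(c * x)) ∂μ
      = ∫ x in Set.Iic 0, Real.exp (-(-c * (-1 * x))) ∂μ := by
    congr 1; funext x; congr 1; ring
  rw [e1, key, ← mul_neg, ← integral_neg,
    ← integral_neg_eq_self (fun t : ℝ => -(1 / (c + t * I) * charFun μ t).re)]
  congr 2
  funext t
  rw [← neg_re, ← neg_mul]
  congr 2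
  have e2 : (((-c : ℝ) : ℂ) + t * I) = -(c + ((-t : ℝ) : ℂ) * I) := by push_cast; ring
  rw [e2, div_neg]

/-! ### The exponent along the vertical line through the saddle point. -/

/-- Frequency scale of the `k`-th factor of the characteristic function at the saddle point. -/
noncomputable def freq {K : ℕ} (Ω : Fin K → ℝ) (s : ℝ) (k : Fin K) : ℝ :=
  2 * Ω k / (1 + 2 * s * Ω k)

/-- Weight of the `k`-th non-centrality parameter at the saddle point. -/
noncomputable def weight {K : ℕ} (Ω : Fin K → ℝ) (s : ℝ) (k : Fin K) : ℝ :=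
  ((1 + Ω k) / Ω k) / (1 + 2 * s * Ω k)

/-- Real part of `(α(s + i t) - α(s)) / 2`. -/
noncomputable def modExponent {K : ℕ} (Ω : Fin K → ℝ) (s t : ℝ) : ℝ :=
  -(1 / (2 * (K : ℝ)) * ∑ k, (weight Ω s k * ((freq Ω s k * t) ^ 2 / (1 + (freq Ω s k * t) ^ 2))
    + Real.log (1 + (freq Ω s k * t) ^ 2) / 2))

/-- Imaginary part of `(α(s + i t) - α(s)) / 2` at a critical point `s` of `α`. -/
noncomputable def phaseExponent {K : ℕ} (Ω : Fin K → ℝ) (s t : ℝ) : ℝ :=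
  1 / (2 * (K : ℝ)) * ∑ k, (weight Ω s k
      * (freq Ω s k * t - freq Ω s k * t / (1 + (freq Ω s k * t) ^ 2))
    + (freq Ω s k * t - Real.arctan (freq Ω s k * t)))

section

variable {K : ℕ} {Ω : Fin K → ℝ} {s : ℝ}

theorem one_add_pos_of_mem_region (hΩ : ∀ k, 0 < Ω k) (hs : s ∈ region Ω) (k : Fin K) :
    0 < 1 + 2 * s * Ω k := by
  have h := hs k
  have := hΩ k
  rw [← neg_div, div_lt_iff₀ (by positivity)] at h
  linarith

theorem freq_pos (hΩ : ∀ k, 0 < Ω k) (hs : s ∈ region Ω) (k : Fin K) : 0 < freq Ω s k := by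
  have := one_add_pos_of_mem_region hΩ hs k
  have := hΩ k
  unfold freq; positivity

theorem weight_pos (hΩ : ∀ k, 0 < Ω k) (hs : s ∈ region Ω) (k : Fin K) : 0 < weight Ω s k := by
  have := one_add_pos_of_mem_region hΩ hs k
  have := hΩ k
  unfold weight; positivity

theorem taylorCoeff_eq (Ω : Fin K → ℝ) (s : ℝ) (j : ℕ) : taylorCoeff Ω s j =
    1 / (K : ℝ) * ∑ k, (weight Ω s k + 1 / (j : ℝ)) * (-freq Ω s k) ^ j := by
  unfold taylorCoeff weight freq
  congr 2
  funext k
  congr 2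
  ring

theorem taylorCoeff_two_pos (hK : 0 < K) (hΩ : ∀ k, 0 < Ω k) (hs : s ∈ region Ω) :
    0 < taylorCoeff Ω s 2 := by
  rw [taylorCoeff_eq]
  have : Nonempty (Fin K) := ⟨⟨0, hK⟩⟩
  have : (0 : ℝ) < K := by exact_mod_cast hK
  refine mul_pos (by positivity) (Finset.sum_pos (fun k _ => ?_) Finset.univ_nonempty)
  have := freq_pos hΩ hs k
  have := weight_pos hΩ hs k
  rw [neg_sq]
  positivity

theorem continuous_modExponent : Continuous (modExponent Ω s) := by
  unfold modExponent
  have h (k : Fin K) (t : ℝ) : 1 + (freq Ω s k * t) ^ 2 ≠ 0 := by positivity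
  fun_prop (disch := simp [h])

theorem continuous_phaseExponent : Continuous (phaseExponent Ω s) := by
  unfold phaseExponent
  have h (k : Fin K) (t : ℝ) : 1 + (freq Ω s k * t) ^ 2 ≠ 0 := by positivity
  fun_prop (disch := simp [h])

/-- Constant in the Taylor bounds for `modExponent` and `phaseExponent`. -/
noncomputable def taylorBound (Ω : Fin K → ℝ) (s : ℝ) : ℝ :=
  1 / (2 * (K : ℝ)) * ∑ k, (weight Ω s k + 1) * (freq Ω s k ^ 6 + freq Ω s k ^ 5)

theorem taylorBound_nonneg (hΩ : ∀ k, 0 < Ω k) (hs : s ∈ region Ω) : 0 ≤ taylorBound Ω s := by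
  refine mul_nonneg (by positivity) (Finset.sum_nonneg fun k _ => ?_)
  have := freq_pos hΩ hs k
  have := weight_pos hΩ hs k
  positivity

/-- With `q = (freq * t) ^ 2`, expand `q / (1 + q) = q - q² + …` and `log (1 + q) / 2 = q / 2 - q² /
4 + …`. The coefficients `weight + 1/2` and `weight + 1/4` are those of `a₂` and `a₄`. -/
theorem abs_modExponent_sub_le (hΩ : ∀ k, 0 < Ω k) (hs : s ∈ region Ω) (t : ℝ) :
    |modExponent Ω s t - (-(taylorCoeff Ω s 2 * t ^ 2 / 2) + taylorCoeff Ω s 4 * t ^ 4 / 2)|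
      ≤ taylorBound Ω s * t ^ 6 := by
  have e : modExponent Ω s t
      - (-(taylorCoeff Ω s 2 * t ^ 2 / 2) + taylorCoeff Ω s 4 * t ^ 4 / 2) =
      -(1 / (2 * (K : ℝ)) * ∑ k, (weight Ω s k * ((freq Ω s k * t) ^ 2 / (1 + (freq Ω s k * t) ^ 2)
        - (freq Ω s k * t) ^ 2 + ((freq Ω s k * t) ^ 2) ^ 2)
        + (Real.log (1 + (freq Ω s k * t) ^ 2)
          - ((freq Ω s k * t) ^ 2 - ((freq Ω s k * t) ^ 2) ^ 2 / 2)) / 2)) := by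
    rw [taylorCoeff_eq, taylorCoeff_eq, modExponent]
    simp only [Finset.mul_sum, Finset.sum_mul, Finset.sum_div, ← Finset.sum_neg_distrib,
      ← Finset.sum_add_distrib, ← Finset.sum_sub_distrib]
    refine Finset.sum_congr rfl fun k _ => ?_
    push_cast
    ring
  rw [e, abs_neg, abs_mul, abs_of_nonneg (by positivity), taylorBound, mul_assoc, Finset.sum_mul]
  gcongr
  refine (Finset.abs_sum_le_sum_abs _ _).trans (Finset.sum_le_sum fun k _ => ?_)
  have hw := freq_pos hΩ hs k
  have hp := weight_pos hΩ hs k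
  set q := (freq Ω s k * t) ^ 2 with hq
  have hq0 : 0 ≤ q := by positivity
  have h1 : |q / (1 + q) - q + q ^ 2| ≤ q ^ 3 := by
    have : q / (1 + q) - q + q ^ 2 = q ^ 3 / (1 + q) := by field_simp; ring
    rw [this, abs_of_nonneg (by positivity)]
    exact div_le_self (by positivity) (by linarith)
  have h2 := abs_log_one_add_sub_le hq0
  have h3 : q ^ 3 = freq Ω s k ^ 6 * t ^ 6 := by rw [hq]; ring
  calc _ ≤ weight Ω s k * q ^ 3 + q ^ 3 := by
        refine (abs_add_le _ _).trans (add_le_add ?_ ?_)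
        · rw [abs_mul, abs_of_pos hp]; gcongr
        · rw [abs_div, abs_two]
          have : 0 ≤ q ^ 3 := by positivity
          linarith
    _ = (weight Ω s k + 1) * freq Ω s k ^ 6 * t ^ 6 := by rw [h3]; ring
    _ ≤ (weight Ω s k + 1) * (freq Ω s k ^ 6 + freq Ω s k ^ 5) * t ^ 6 := by
        gcongr
        have : 0 ≤ freq Ω s k ^ 5 := by positivity
        linarith

/-- With `x = freq * t`, both `x - x / (1 + x²) = x³ + …` and `x - arctan x = x³ / 3 + …` start at
third order and produce `weight + 1/3`; the sign comes from `(-freq) ^ 3` in `a₃`. -/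
theorem abs_phaseExponent_add_le (hΩ : ∀ k, 0 < Ω k) (hs : s ∈ region Ω) (t : ℝ) :
    |phaseExponent Ω s t + taylorCoeff Ω s 3 * t ^ 3 / 2| ≤ taylorBound Ω s * |t| ^ 5 := by
  have e : phaseExponent Ω s t + taylorCoeff Ω s 3 * t ^ 3 / 2 =
      1 / (2 * (K : ℝ)) * ∑ k, (weight Ω s k * (freq Ω s k * t
        - freq Ω s k * t / (1 + (freq Ω s k * t) ^ 2) - (freq Ω s k * t) ^ 3)
        + -(Real.arctan (freq Ω s k * t) - (freq Ω s k * t - (freq Ω s k * t) ^ 3 / 3))) := by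
    rw [taylorCoeff_eq, phaseExponent]
    simp only [Finset.mul_sum, Finset.sum_mul, Finset.sum_div, ← Finset.sum_add_distrib]
    refine Finset.sum_congr rfl fun k _ => ?_
    push_cast
    ring
  rw [e, abs_mul, abs_of_nonneg (by positivity), taylorBound, mul_assoc, Finset.sum_mul]
  gcongr
  refine (Finset.abs_sum_le_sum_abs _ _).trans (Finset.sum_le_sum fun k _ => ?_)
  have hw := freq_pos hΩ hs k
  have hp := weight_pos hΩ hs k
  set x := freq Ω s k * t with hx
  have h1 : |x - x / (1 + x ^ 2) - x ^ 3| ≤ |x| ^ 5 := by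
    have : x - x / (1 + x ^ 2) - x ^ 3 = -(x ^ 5 / (1 + x ^ 2)) := by field_simp; ring
    rw [this, abs_neg, abs_div, abs_pow, abs_of_pos (show 0 < 1 + x ^ 2 by positivity)]
    exact div_le_self (by positivity) (by nlinarith [sq_nonneg x])
  have h2 := abs_arctan_sub_le x
  have h3 : |x| ^ 5 = freq Ω s k ^ 5 * |t| ^ 5 := by rw [hx, abs_mul, abs_of_pos hw, mul_pow]
  calc _ ≤ weight Ω s k * |x| ^ 5 + |x| ^ 5 := by
        refine (abs_add_le _ _).trans (add_le_add ?_ ?_)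
        · rw [abs_mul, abs_of_pos hp]; gcongr
        · rw [abs_neg]; exact h2
    _ = (weight Ω s k + 1) * freq Ω s k ^ 5 * |t| ^ 5 := by rw [h3]; ring
    _ ≤ (weight Ω s k + 1) * (freq Ω s k ^ 6 + freq Ω s k ^ 5) * |t| ^ 5 := by
        gcongr
        have : 0 ≤ freq Ω s k ^ 6 := by positivity
        linarith

/-- Dropping the nonnegative weighted terms and replacing every frequency by the smallest one leaves
`K` equal logarithms, which cancel the averaging factor. Thus `exp (n R)` decays like a power of `1
+ (w t) ^ 2` proportional to `n`. -/
theorem exists_modExponent_le (hK : 0 < K) (hΩ : ∀ k, 0 < Ω k) (hs : s ∈ region Ω) :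
    ∃ w, 0 < w ∧ ∀ t, modExponent Ω s t ≤ -(Real.log (1 + (w * t) ^ 2) / 4) := by
  have : Nonempty (Fin K) := ⟨⟨0, hK⟩⟩
  have hK' : (0 : ℝ) < K := by exact_mod_cast hK
  obtain ⟨k0, hk0⟩ := Finite.exists_min (freq Ω s)
  refine ⟨freq Ω s k0, freq_pos hΩ hs k0, fun t => ?_⟩
  have h : ∑ _k : Fin K, Real.log (1 + (freq Ω s k0 * t) ^ 2) / 2 ≤
      ∑ k, (weight Ω s k * ((freq Ω s k * t) ^ 2 / (1 + (freq Ω s k * t) ^ 2))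
        + Real.log (1 + (freq Ω s k * t) ^ 2) / 2) := by
    refine Finset.sum_le_sum fun k _ => ?_
    have := weight_pos hΩ hs k
    have h1 : 0 ≤ weight Ω s k * ((freq Ω s k * t) ^ 2 / (1 + (freq Ω s k * t) ^ 2)) := by
      positivity
    have h2 : Real.log (1 + (freq Ω s k0 * t) ^ 2) ≤ Real.log (1 + (freq Ω s k * t) ^ 2) := by
      have := hk0 k
      have := (freq_pos hΩ hs k0).le
      rw [mul_pow, mul_pow]
      gcongr
    linarith
  rw [Finset.sum_const, Finset.card_univ, Fintype.card_fin, nsmul_eq_mul] at h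
  unfold modExponent
  have := mul_le_mul_of_nonneg_left h (show 0 ≤ 1 / (2 * (K : ℝ)) by positivity)
  have e : 1 / (2 * (K : ℝ)) * (K * (Real.log (1 + (freq Ω s k0 * t) ^ 2) / 2))
      = Real.log (1 + (freq Ω s k0 * t) ^ 2) / 4 := by
    field_simp; ring
  linarith

/-- The region is open, so the minimizer is a critical point of `α`. This is the only place where
minimality enters; it removes the linear term of the phase. -/
theorem IsSaddlePoint.lam_eq {lam : ℝ} (hΩ : ∀ k, 0 < Ω k)
    (h : IsSaddlePoint Ω lam s) :
    lam = 1 / (2 * (K : ℝ)) * ∑ k, (weight Ω s k * freq Ω s k + freq Ω s k) := by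
  obtain ⟨hs, hmin⟩ := h
  have hopen : IsOpen (region Ω) := by
    have : region Ω = ⋂ k, Set.Ioi (-(1 / (2 * Ω k))) := by
      ext x; simp [region]
    rw [this]
    exact isOpen_iInter_of_finite fun k => isOpen_Ioi
  have hloc := hmin.isLocalMin (hopen.mem_nhds hs)
  have hd : HasDerivAt (α Ω lam)
      (2 * lam - 1 / (K : ℝ) * ∑ k, (weight Ω s k * freq Ω s k + freq Ω s k)) s := by
    have hk (k : Fin K) : HasDerivAt (fun s => 2 * s * (1 + Ω k) / (1 + 2 * s * Ω k)
        + Real.log (1 + 2 * s * Ω k)) (weight Ω s k * freq Ω s k + freq Ω s k) s := by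
      have hv := (one_add_pos_of_mem_region hΩ hs k).ne'
      have hΩk := (hΩ k).ne'
      have h1 : HasDerivAt (fun s : ℝ => 2 * s * (1 + Ω k)) (2 * (1 + Ω k)) s := by
        simpa using ((hasDerivAt_id s).const_mul 2).mul_const (1 + Ω k)
      have h2 : HasDerivAt (fun s : ℝ => 1 + 2 * s * Ω k) (2 * Ω k) s := by
        simpa using (((hasDerivAt_id s).const_mul 2).mul_const (Ω k)).const_add 1
      refine ((h1.div h2 hv).add (h2.log hv)).congr_deriv ?_
      unfold weight freq
      field_simp
      ring
    have h3 : HasDerivAt (fun s : ℝ => 2 * lam * s) (2 * lam) s := by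
      simpa using (hasDerivAt_id s).const_mul (2 * lam)
    have := h3.sub ((HasDerivAt.fun_sum (u := Finset.univ) fun k _ => hk k).const_mul (1 / (K : ℝ)))
    exact this
  have h0 := hloc.hasDerivAt_eq_zero hd
  have : lam = 1 / 2 * (1 / (K : ℝ) * ∑ k, (weight Ω s k * freq Ω s k + freq Ω s k)) := by linarith
  rw [this]
  ring

end

/-! ### The Laplace transform of the score. -/

open Complex in
theorem one_add_mul_I_eq_exp (x : ℝ) :
    (1 + x * I : ℂ) = cexp (((Real.log (1 + x ^ 2) / 2 : ℝ) : ℂ) + (Real.arctan x : ℝ) * I) := by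
  have h0 : 0 < 1 + x ^ 2 := by positivity
  have hexp : Real.exp (Real.log (1 + x ^ 2) / 2) = √(1 + x ^ 2) := by
    rw [Real.sqrt_eq_rpow, Real.rpow_def_of_pos h0]; congr 1; ring
  have hs : √(1 + x ^ 2) ≠ 0 := (Real.sqrt_pos.2 h0).ne'
  rw [Complex.exp_add, ← Complex.ofReal_exp, hexp, Complex.exp_mul_I, ← Complex.ofReal_cos,
    ← Complex.ofReal_sin, Real.cos_arctan, Real.sin_arctan, mul_add, ← mul_assoc,
    ← Complex.ofReal_mul, ← Complex.ofReal_mul, mul_one_div_cancel hs, mul_div_cancel₀ _ hs]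
  simp

-- The argument `arctan x` lies in `(-π/2, π/2)`, so the principal branch inverts the polar form
-- exactly.
open Complex in
theorem log_one_add_mul_I (x : ℝ) :
    Complex.log (1 + x * I) = ((Real.log (1 + x ^ 2) / 2 : ℝ) : ℂ) + (Real.arctan x : ℝ) * I := by
  have him : (((Real.log (1 + x ^ 2) / 2 : ℝ) : ℂ) + (Real.arctan x : ℝ) * I).im
      = Real.arctan x := by
    rw [add_im, ofReal_im, im_ofReal_mul, I_im, zero_add, mul_one]
  have h1 := Real.neg_pi_div_two_lt_arctan x
  have h2 := Real.arctan_lt_pi_div_two x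
  rw [one_add_mul_I_eq_exp, Complex.log_exp] <;> rw [him] <;> linarith [Real.pi_pos]

open Complex in
/-- Real and imaginary parts of one summand of the exponent on the vertical line through `s`. -/
theorem block_exponent_eq {O s : ℝ} (lam t : ℝ) (hO : 0 < O) (hv : 0 < 1 + 2 * s * O) :
    (s + t * I) * lam - 1 / 2 * Complex.log (1 + 2 * (s + t * I) * O)
      - (s + t * I) * (1 + O) / (1 + 2 * (s + t * I) * O) =
    ((s * lam - Real.log (1 + 2 * s * O) / 2 - s * (1 + O) / (1 + 2 * s * O)
      - 1 / 2 * (((1 + O) / O) / (1 + 2 * s * O) * ((2 * O / (1 + 2 * s * O) * t) ^ 2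
          / (1 + (2 * O / (1 + 2 * s * O) * t) ^ 2))
        + Real.log (1 + (2 * O / (1 + 2 * s * O) * t) ^ 2) / 2) : ℝ) : ℂ)
    + ((t * lam - 1 / 2 * (((1 + O) / O) / (1 + 2 * s * O) * (2 * O / (1 + 2 * s * O) * t
          / (1 + (2 * O / (1 + 2 * s * O) * t) ^ 2))
        + Real.arctan (2 * O / (1 + 2 * s * O) * t)) : ℝ) : ℂ) * I := by
  set v := 1 + 2 * s * O with hvdef
  set x := 2 * O / v * t with hx
  -- Pulling out the positive real factor `v` splits the logarithm without a branch correction and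
  -- leaves `1 + i x` with `x` the scaled frequency.
  have hfac : (1 + 2 * (s + t * I) * O : ℂ) = (v : ℝ) * (1 + x * I) := by
    have : (v : ℂ) * x = 2 * O * t := by
      rw [← ofReal_mul, hx]
      have : v * (2 * O / v * t) = 2 * O * t := by field_simp
      rw [this]; push_cast; ring
    have hv' : (v : ℂ) = 1 + 2 * s * O := by rw [hvdef]; push_cast; rfl
    linear_combination -hv' - I * this
  have hx0 : (1 + x * I : ℂ) ≠ 0 := by rw [one_add_mul_I_eq_exp]; exact Complex.exp_ne_zero _
  have hinv : (1 + x * I : ℂ)⁻¹ = ((1 / (1 + x ^ 2) : ℝ) : ℂ) - ((x / (1 + x ^ 2) : ℝ) : ℂ) * I := by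
    have h1 : ((1 + x ^ 2 : ℝ) : ℂ) ≠ 0 := by
      rw [Ne, ofReal_eq_zero]; positivity
    rw [inv_eq_iff_eq_inv, eq_comm, inv_eq_iff_eq_inv, ← sub_eq_zero]
    apply mul_right_cancel₀ hx0
    rw [sub_mul, inv_mul_cancel₀ hx0]
    push_cast at h1 ⊢
    field_simp
    ring_nf
    simp only [I_sq]
    ring
  have hvc : (v : ℂ) ≠ 0 := by exact_mod_cast hv.ne'
  have hOc : (O : ℂ) ≠ 0 := by exact_mod_cast hO.ne'
  -- The rational term is affine in the reciprocal of `1 + 2 z O`, whose real and imaginary parts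
  -- are known from `hinv`.
  have hz : (s + t * I : ℂ) * (1 + O) / (1 + 2 * (s + t * I) * O)
      = (1 + O) / (2 * O) * (1 - (1 / v) * (1 + x * I)⁻¹) := by
    have h2 : (1 + 2 * (s + t * I) * O : ℂ) ≠ 0 := by rw [hfac]; exact mul_ne_zero hvc hx0
    have h3 : (1 / v : ℂ) * (1 + x * I)⁻¹ = (1 + 2 * (s + t * I) * O : ℂ)⁻¹ := by
      rw [hfac, mul_inv, one_div]
    rw [h3, div_eq_iff h2, mul_assoc, sub_mul, inv_mul_cancel₀ h2]
    field_simp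
    ring
  rw [hz, hfac, Complex.log_ofReal_mul hv hx0, log_one_add_mul_I, hinv]
  have hsr : s * (1 + O) / v = (1 + O) / (2 * O) * (1 - 1 / v) := by
    have : 2 * s * O = v - 1 := by rw [hvdef]; ring
    rw [div_eq_iff hv.ne', mul_assoc, sub_mul, one_div, inv_mul_cancel₀ hv.ne', one_mul, ← this]
    field_simp
  have hq : x ^ 2 / (1 + x ^ 2) = 1 - 1 / (1 + x ^ 2) := by field_simp; ring
  rw [hsr, hq]
  push_cast
  field_simp
  ring

/-- `n λ - Λ'`, where `Λ'` is the quadratic statistic of the likelihood ratio. -/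
noncomputable def score {K m : ℕ} (σ Ω : Fin K → ℝ) (lam : ℝ) (a b : Word K m) : ℝ :=
  ∑ k, (m * lam - Ω k / (σ k ^ 2 * (1 + Ω k)) * ‖b k - ((1 + Ω k) / Ω k) • a k‖ ^ 2)

theorem norm_sub_smul_sq {m : ℕ} (r : ℝ) (A v : EuclideanSpace ℝ (Fin m)) :
    ‖v - r • A‖ ^ 2 = ‖v‖ ^ 2 - 2 * r * inner ℝ A v + r ^ 2 * ‖A‖ ^ 2 := by
  rw [norm_sub_sq_real, inner_smul_right, norm_smul, mul_pow, Real.norm_eq_abs, sq_abs,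
    real_inner_comm]
  ring

-- For `y` in the right half plane the argument is not `π`, so the principal branch satisfies `log
-- y⁻¹ = -log y`.
open Complex in
theorem cpow_mul_inv_eq {d : ℝ} (hd : 0 < d) {y : ℂ} (hy : 0 < y.re) (r : ℝ) :
    ((d : ℂ) * y⁻¹) ^ (r : ℂ) = (d ^ r : ℝ) * cexp (-r * Complex.log y) := by
  have hy0 : y ≠ 0 := fun h => by simp [h] at hy
  have hdc : (d : ℂ) ≠ 0 := by exact_mod_cast hd.ne'
  have harg : y.arg ≠ Real.pi := fun h => by
    have := (Complex.arg_eq_pi_iff.1 h).1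
    linarith
  rw [Complex.cpow_def_of_ne_zero (mul_ne_zero hdc (inv_ne_zero hy0)),
    Complex.log_ofReal_mul hd (inv_ne_zero hy0), Complex.log_inv _ harg, add_mul, Complex.exp_add,
    Real.rpow_def_of_pos hd]
  push_cast
  congr 2
  ring

open Complex in
/-- The bilateral Laplace transform of one block of the score. -/
theorem integral_block {m : ℕ} {s O lam : ℝ} (hs : 0 < s) (hO : 0 < O)
    (A : EuclideanSpace ℝ (Fin m)) (hA : ‖A‖ ^ 2 = m * (O * s ^ 2)) {z : ℂ}
    (hz : 0 < (1 + 2 * z * O).re) :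
    ∫ v : EuclideanSpace ℝ (Fin m),
      ((1 / (2 * Real.pi * s ^ 2 * (1 + O)) ^ ((m : ℝ) / 2)
        * Real.exp (-‖v‖ ^ 2 / (2 * s ^ 2 * (1 + O))) : ℝ) : ℂ)
        * cexp (z * ((m * lam - O / (s ^ 2 * (1 + O)) * ‖v - ((1 + O) / O) • A‖ ^ 2 : ℝ) : ℂ))
      = cexp (m * (z * lam - 1 / 2 * Complex.log (1 + 2 * z * O)
          - z * (1 + O) / (1 + 2 * z * O))) := by
  set d := 2 * Real.pi * s ^ 2 * (1 + O) with hd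
  have hd0 : 0 < d := by positivity
  set y := 1 + 2 * z * O with hy
  have hy0 : y ≠ 0 := fun h => by simp [h] at hz
  set B : ℂ := ((1 / (2 * s ^ 2 * (1 + O)) : ℝ) : ℂ) * y with hB
  have hBre : 0 < B.re := by
    rw [hB, re_ofReal_mul]; positivity
  have hsc : (s : ℂ) ≠ 0 := by exact_mod_cast hs.ne'
  have hOc : (O : ℂ) ≠ 0 := by exact_mod_cast hO.ne'
  have hO1 : (1 + O : ℂ) ≠ 0 := by
    have : (1 + O : ℝ) ≠ 0 := by positivity
    exact_mod_cast this
  have hAc : (‖A‖ : ℂ) ^ 2 = m * (O * s ^ 2) := by exact_mod_cast congrArg ((↑) : ℝ → ℂ) hA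
  -- Density and statistic merge into a single complex Gaussian with quadratic coefficient `B = (1 +
  -- 2 z O) / (2 s² (1 + O))`; its real part is positive exactly under `hz`.
  have hpt (v : EuclideanSpace ℝ (Fin m)) :
      ((1 / d ^ ((m : ℝ) / 2) * Real.exp (-‖v‖ ^ 2 / (2 * s ^ 2 * (1 + O))) : ℝ) : ℂ)
        * cexp (z * ((m * lam - O / (s ^ 2 * (1 + O)) * ‖v - ((1 + O) / O) • A‖ ^ 2 : ℝ) : ℂ))
      = ((1 / d ^ ((m : ℝ) / 2) : ℝ) : ℂ) * cexp (z * (m * lam) - z * (m * (1 + O)))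
        * cexp (-B * ‖v‖ ^ 2 + (2 * z / s ^ 2) * inner ℝ A v) := by
    rw [norm_sub_smul_sq, hA, ofReal_mul, ofReal_exp,
      mul_assoc ((1 / d ^ ((m : ℝ) / 2) : ℝ) : ℂ), mul_assoc ((1 / d ^ ((m : ℝ) / 2) : ℝ) : ℂ),
      ← Complex.exp_add, ← Complex.exp_add]
    congr 2
    rw [hB, hy]
    push_cast
    field_simp
    ring
  simp_rw [hpt]
  rw [integral_const_mul, GaussianFourier.integral_cexp_neg_mul_sq_norm_add hBre,
    finrank_euclideanSpace, Fintype.card_fin, hAc]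
  -- In `(π / B) ^ (m / 2)` the factor from `d` cancels the normalization of the density, and `y⁻¹`
  -- gives the logarithmic term of the exponent.
  have hπB : (Real.pi / B : ℂ) = (d : ℂ) * y⁻¹ := by
    rw [hB, hd]
    push_cast
    field_simp
  have hexp : ((m : ℂ) / 2) = (((m : ℝ) / 2 : ℝ) : ℂ) := by push_cast; rfl
  rw [hπB, hexp, cpow_mul_inv_eq hd0 hz]
  have hdp : ((d ^ ((m : ℝ) / 2) : ℝ) : ℂ) ≠ 0 := by
    exact_mod_cast (Real.rpow_pos_of_pos hd0 _).ne'
  rw [ofReal_div, ofReal_one]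
  calc _ = (1 / ((d ^ ((m : ℝ) / 2) : ℝ) : ℂ) * ((d ^ ((m : ℝ) / 2) : ℝ) : ℂ)) *
      (cexp (z * (m * lam) - z * (m * (1 + O))) *
        cexp (-(((m : ℝ) / 2 : ℝ) : ℂ) * Complex.log y) *
        cexp ((2 * z / s ^ 2) ^ 2 * (m * (O * s ^ 2)) / (4 * B))) := by ring
    _ = _ := by
      rw [one_div_mul_cancel hdp, one_mul, ← Complex.exp_add, ← Complex.exp_add]
      congr 1
      have h2 : (2 * z / s ^ 2) ^ 2 * (m * (O * s ^ 2)) / (4 * B)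
          = m * (1 + O) * z * (y - 1) / y := by
        rw [show y - 1 = 2 * z * O by rw [hy]; ring, hB]
        push_cast
        field_simp
        ring
      rw [h2]
      push_cast
      field_simp
      ring

section

variable {K m : ℕ} {σ Ω : Fin K → ℝ} {a : Word K m}

theorem outputPDF_pos (hσ : ∀ k, 0 < σ k) (hΩ : ∀ k, 0 < Ω k) (b : Word K m) :
    0 < outputPDF σ Ω b := by
  refine Finset.prod_pos fun k _ => ?_
  have := hσ k
  have := hΩ k
  positivity

theorem continuous_outputPDF : Continuous (outputPDF (m := m) σ Ω) := by
  unfold outputPDF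
  simp only [div_eq_mul_inv]
  fun_prop

theorem continuous_score (lam : ℝ) : Continuous (score σ Ω lam a) := by
  unfold score
  fun_prop

open Complex in
/-- The bilateral Laplace transform of the score under the output law. -/
theorem integral_outputPDF_mul_cexp (lam : ℝ) (hσ : ∀ k, 0 < σ k) (hΩ : ∀ k, 0 < Ω k)
    (ha : ∀ k, ‖a k‖ ^ 2 = m * (Ω k * σ k ^ 2)) {z : ℂ} (hz : ∀ k, 0 < (1 + 2 * z * Ω k).re) :
    ∫ b : Word K m, (outputPDF σ Ω b : ℂ) * cexp (z * (score σ Ω lam a b : ℝ))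
      = cexp (∑ k, m * (z * lam - 1 / 2 * Complex.log (1 + 2 * z * Ω k)
          - z * (1 + Ω k) / (1 + 2 * z * Ω k))) := by
  rw [Complex.exp_sum, ← Finset.prod_congr rfl fun k _ =>
    integral_block (lam := lam) (hσ k) (hΩ k) (a k) (ha k) (hz k),
    ← integral_fintype_prod_volume_eq_prod (𝕜 := ℂ)]
  congr 1
  funext b
  rw [Finset.prod_mul_distrib, outputPDF, score, ofReal_prod, ofReal_sum, Finset.mul_sum,
    Complex.exp_sum]

/-- The saddle point equation is needed for the imaginary part only: it rewrites `K * t * lam` as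
the linear terms inside `phaseExponent`. -/
theorem sum_block_exponent_eq (hK : 0 < K) {lam s : ℝ} (hΩ : ∀ k, 0 < Ω k)
    (h : IsSaddlePoint Ω lam s) (m : ℕ) (t : ℝ) :
    ∑ k, (m : ℂ) * ((s + t * Complex.I) * lam
        - 1 / 2 * Complex.log (1 + 2 * (s + t * Complex.I) * Ω k)
        - (s + t * Complex.I) * (1 + Ω k) / (1 + 2 * (s + t * Complex.I) * Ω k))
      = (((K * m : ℕ) / 2 * α Ω lam s + (K * m : ℕ) * modExponent Ω s t : ℝ) : ℂ)
        + (((K * m : ℕ) * phaseExponent Ω s t : ℝ) : ℂ) * Complex.I := by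
  have hK' : (K : ℝ) ≠ 0 := by exact_mod_cast hK.ne'
  have hlam : (K : ℝ) * lam = ∑ k, 1 / 2 * (weight Ω s k * freq Ω s k + freq Ω s k) := by
    rw [h.lam_eq hΩ, ← Finset.mul_sum]
    field_simp
  rw [Finset.sum_congr rfl fun k _ => by
    rw [block_exponent_eq lam t (hΩ k) (one_add_pos_of_mem_region hΩ h.1 k)]]
  simp only [mul_add, ← mul_assoc]
  rw [Finset.sum_add_distrib, ← Finset.sum_mul]
  simp only [← Complex.ofReal_natCast (n := m), ← Complex.ofReal_mul]
  rw [← Complex.ofReal_sum, ← Complex.ofReal_sum]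
  congr 3
  · have h1 : (K : ℝ) * (2 * lam * s - α Ω lam s) = ∑ k,
        (2 * s * (1 + Ω k) / (1 + 2 * s * Ω k) + Real.log (1 + 2 * s * Ω k)) := by
      rw [α]; field_simp; ring
    have h2 : 2 * (K : ℝ) * (-modExponent Ω s t) = ∑ k, (weight Ω s k *
        ((freq Ω s k * t) ^ 2 / (1 + (freq Ω s k * t) ^ 2))
        + Real.log (1 + (freq Ω s k * t) ^ 2) / 2) := by
      rw [modExponent, neg_neg, ← mul_assoc, mul_one_div_cancel (by positivity), one_mul]
    have h3 : ∑ _k : Fin K, s * lam = K * (s * lam) := by simp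
    have h4 : ((K * m : ℕ) / 2 * α Ω lam s + (K * m : ℕ) * modExponent Ω s t : ℝ)
        = m * (K * (s * lam) - 1 / 2 * (K * (2 * lam * s - α Ω lam s))
          - 1 / 2 * (2 * K * (-modExponent Ω s t))) := by
      push_cast; ring
    rw [h4, h1, h2, ← h3, Finset.mul_sum, Finset.mul_sum, ← Finset.sum_sub_distrib,
      ← Finset.sum_sub_distrib, Finset.mul_sum]
    refine Finset.sum_congr rfl fun k _ => ?_
    unfold weight freq
    ring
  · have h2 : 2 * (K : ℝ) * phaseExponent Ω s t = ∑ k, (weight Ω s k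
        * (freq Ω s k * t - freq Ω s k * t / (1 + (freq Ω s k * t) ^ 2))
        + (freq Ω s k * t - Real.arctan (freq Ω s k * t))) := by
      rw [phaseExponent, ← mul_assoc, mul_one_div_cancel (by positivity), one_mul]
    have h4 : ((K * m : ℕ) * phaseExponent Ω s t : ℝ)
        = m * (1 / 2 * (2 * K * phaseExponent Ω s t) - t * (K * lam) + K * (t * lam)) := by
      push_cast; ring
    have h3 : ∑ _k : Fin K, t * lam = K * (t * lam) := by simp
    rw [h4, h2, hlam, ← h3, Finset.mul_sum, Finset.mul_sum, ← Finset.sum_sub_distrib,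
      ← Finset.sum_add_distrib, Finset.mul_sum]
    refine Finset.sum_congr rfl fun k _ => ?_
    unfold weight freq
    ring

end

/-! ### Tilting, and the error probabilities as saddle point integrals. -/

/-- Probabilities under an exponentially tilted density. -/
theorem withDensity_real_preimage {X : Type*} [MeasurableSpace X] (μ : Measure X) {p q S : X → ℝ}
    {C c : ℝ} (hp : Measurable p) (hq : Measurable q) (hS : Measurable S) (hp0 : ∀ x, 0 ≤ p x)
    (hq0 : ∀ x, 0 ≤ q x) (hpq : ∀ x, p x = C * (q x * Real.exp (-(c * S x)))) {s : Set ℝ}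
    (hs : MeasurableSet s) :
    (μ.withDensity fun x => ENNReal.ofReal (p x)).real (S ⁻¹' s)
      = C * ∫ x in s, Real.exp (-(c * x))
          ∂((μ.withDensity fun x => ENNReal.ofReal (q x)).map S) := by
  have hm : MeasurableSet (S ⁻¹' s) := hS hs
  rw [setIntegral_map hs (Continuous.aestronglyMeasurable (by fun_prop)) hS.aemeasurable,
    setIntegral_withDensity_eq_setIntegral_toReal_smul hq.ennreal_ofReal
      (Filter.Eventually.of_forall fun x => ENNReal.ofReal_lt_top) _ hm,
    ← integral_const_mul, measureReal_def, withDensity_apply _ hm,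
    ← integral_eq_lintegral_of_nonneg_ae (Filter.Eventually.of_forall hp0)
      hp.aestronglyMeasurable.restrict]
  congr 1
  funext x
  rw [hpq, ENNReal.toReal_ofReal (hq0 x), smul_eq_mul]

section

variable {K m : ℕ} {σ Ω : Fin K → ℝ} {a : Word K m}

theorem log_two_mul_capacity (Ω : Fin K → ℝ) :
    Real.log 2 * capacity Ω = 1 / (K : ℝ) * ∑ k, 1 / 2 * Real.log (1 + Ω k) := by
  have : Real.log 2 ≠ 0 := (Real.log_pos one_lt_two).ne'
  rw [capacity, mul_left_comm, Finset.mul_sum]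
  congr 2
  funext k
  rw [Real.logb]
  field_simp

/-- Complete the square in each block: the log-ratio of the two Gaussians is quadratic in `b k` with
centre `((1 + Ω k) / Ω k) • a k`, and the energy constraint turns its maximum into `m / 2` plus the
capacity term. -/
theorem channelPDF_eq (hK : 0 < K) (lam : ℝ) (hσ : ∀ k, 0 < σ k) (hΩ : ∀ k, 0 < Ω k)
    (ha : ∀ k, ‖a k‖ ^ 2 = m * (Ω k * σ k ^ 2)) (b : Word K m) :
    channelPDF σ a b = outputPDF σ Ω b
      * Real.exp ((K * m : ℕ) * threshold Ω lam + score σ Ω lam a b / 2) := by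
  have hK' : (K : ℝ) ≠ 0 := by exact_mod_cast hK.ne'
  have hsum : ((K * m : ℕ) * threshold Ω lam + score σ Ω lam a b / 2 : ℝ)
      = ∑ k, (m / 2 * Real.log (1 + Ω k) + (m / 2 - Ω k / (σ k ^ 2 * (1 + Ω k))
        * ‖b k - ((1 + Ω k) / Ω k) • a k‖ ^ 2 / 2)) := by
    have h1 : ∑ k : Fin K, (m / 2 * Real.log (1 + Ω k))
        = (K * m) * (Real.log 2 * capacity Ω) := by
      rw [log_two_mul_capacity, ← Finset.mul_sum, ← Finset.mul_sum]
      field_simp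
    have h2 : ∑ k : Fin K, Ω k / (σ k ^ 2 * (1 + Ω k)) * ‖b k - ((1 + Ω k) / Ω k) • a k‖ ^ 2 / 2
        = (∑ k : Fin K, Ω k / (σ k ^ 2 * (1 + Ω k)) * ‖b k - ((1 + Ω k) / Ω k) • a k‖ ^ 2) / 2 :=
      (Finset.sum_div _ _ _).symm
    rw [Finset.sum_add_distrib, h1, Finset.sum_sub_distrib, h2, score, Finset.sum_sub_distrib,
      threshold]
    simp only [Finset.sum_const, Finset.card_univ, Fintype.card_fin, nsmul_eq_mul]
    push_cast
    ring
  rw [hsum, Real.exp_sum, channelPDF, outputPDF, ← Finset.prod_mul_distrib]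
  refine Finset.prod_congr rfl fun k _ => ?_
  have hs := hσ k
  have hO := hΩ k
  rw [Real.mul_rpow (x := 2 * Real.pi * σ k ^ 2) (y := 1 + Ω k) (by positivity) (by positivity),
    Real.rpow_def_of_pos (x := 1 + Ω k)
    (by positivity), Real.exp_add, norm_sub_smul_sq, ha]
  have h2 : ‖b k - a k‖ ^ 2 = ‖b k‖ ^ 2 - 2 * inner ℝ (a k) (b k) + m * (Ω k * σ k ^ 2) := by
    have := norm_sub_smul_sq 1 (a k) (b k)
    rw [one_smul, ha] at this
    rw [this]; ring
  rw [h2, show (m : ℝ) / 2 * Real.log (1 + Ω k) = Real.log (1 + Ω k) * (m / 2) by ring]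
  have h3 : Real.exp (-(‖b k‖ ^ 2 - 2 * inner ℝ (a k) (b k) + m * (Ω k * σ k ^ 2))
        / (2 * σ k ^ 2))
      = Real.exp (-‖b k‖ ^ 2 / (2 * σ k ^ 2 * (1 + Ω k))) *
        Real.exp (m / 2 - Ω k / (σ k ^ 2 * (1 + Ω k)) * (‖b k‖ ^ 2
          - 2 * ((1 + Ω k) / Ω k) * inner ℝ (a k) (b k)
          + ((1 + Ω k) / Ω k) ^ 2 * (m * (Ω k * σ k ^ 2))) / 2) := by
    rw [← Real.exp_add]
    congr 1
    field_simp
    ring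
  rw [h3]
  have := (Real.exp_pos (Real.log (1 + Ω k) * (m / 2))).ne'
  field_simp

theorem logLikelihood_eq (hK : 0 < K) (hm : 0 < m) (lam : ℝ) (hσ : ∀ k, 0 < σ k)
    (hΩ : ∀ k, 0 < Ω k) (ha : ∀ k, ‖a k‖ ^ 2 = m * (Ω k * σ k ^ 2)) (b : Word K m) :
    logLikelihood σ Ω a b
      = threshold Ω lam + 1 / (2 * ((K * m : ℕ) : ℝ)) * score σ Ω lam a b := by
  have hn : ((K * m : ℕ) : ℝ) ≠ 0 := by exact_mod_cast (Nat.mul_pos hK hm).ne'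
  rw [logLikelihood, channelPDF_eq hK lam hσ hΩ ha, mul_div_cancel_left₀ _ (outputPDF_pos hσ hΩ b).ne',
    Real.log_exp]
  field_simp

/-- The law of the score under the exponentially tilted output law, up to normalization. -/
noncomputable def tiltedScoreLaw (σ Ω : Fin K → ℝ) (lam s : ℝ) (a : Word K m) : Measure ℝ :=
  ((volume : Measure (Word K m)).withDensity fun b =>
    ENNReal.ofReal (outputPDF σ Ω b * Real.exp (s * score σ Ω lam a b))).map (score σ Ω lam a)

variable {lam s : ℝ}

theorem integral_tilted (hK : 0 < K) (hσ : ∀ k, 0 < σ k) (hΩ : ∀ k, 0 < Ω k)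
    (ha : ∀ k, ‖a k‖ ^ 2 = m * (Ω k * σ k ^ 2)) (h : IsSaddlePoint Ω lam s) (t : ℝ) :
    ∫ b : Word K m, ((outputPDF σ Ω b * Real.exp (s * score σ Ω lam a b) : ℝ) : ℂ)
        * Complex.exp (t * (score σ Ω lam a b : ℝ) * Complex.I)
      = Complex.exp ((((K * m : ℕ) / 2 * α Ω lam s + (K * m : ℕ) * modExponent Ω s t : ℝ) : ℂ)
        + (((K * m : ℕ) * phaseExponent Ω s t : ℝ) : ℂ) * Complex.I) := by
  rw [← sum_block_exponent_eq hK hΩ h, ← integral_outputPDF_mul_cexp lam hσ hΩ ha]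
  · congr 1
    funext b
    rw [Complex.ofReal_mul, Complex.ofReal_exp, mul_assoc, ← Complex.exp_add]
    congr 2
    push_cast
    ring
  · intro k
    have := one_add_pos_of_mem_region hΩ h.1 k
    simpa using this

/-- The Bochner integral of a non-integrable function is `0`, whereas the transform at `t = 0` is an
exponential; hence the tilted density is integrable. -/
theorem isFiniteMeasure_tilted (hK : 0 < K) (hσ : ∀ k, 0 < σ k) (hΩ : ∀ k, 0 < Ω k)
    (ha : ∀ k, ‖a k‖ ^ 2 = m * (Ω k * σ k ^ 2)) (h : IsSaddlePoint Ω lam s) :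
    IsFiniteMeasure ((volume : Measure (Word K m)).withDensity fun b =>
      ENNReal.ofReal (outputPDF σ Ω b * Real.exp (s * score σ Ω lam a b))) := by
  have h0 := integral_tilted hK hσ hΩ ha h 0
  simp only [Complex.ofReal_zero, zero_mul, Complex.exp_zero, mul_one] at h0
  have hi : Integrable fun b : Word K m =>
      ((outputPDF σ Ω b * Real.exp (s * score σ Ω lam a b) : ℝ) : ℂ) :=
    Integrable.of_integral_ne_zero (by rw [h0]; exact Complex.exp_ne_zero _)
  exact isFiniteMeasure_withDensity_ofReal (Integrable.re hi).hasFiniteIntegral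

theorem measurable_tilted : Measurable fun b : Word K m =>
    outputPDF σ Ω b * Real.exp (s * score σ Ω lam a b) :=
  (continuous_outputPDF.mul ((continuous_score lam).const_mul s).rexp).measurable

theorem charFun_tiltedScoreLaw (hK : 0 < K) (hσ : ∀ k, 0 < σ k) (hΩ : ∀ k, 0 < Ω k)
    (ha : ∀ k, ‖a k‖ ^ 2 = m * (Ω k * σ k ^ 2)) (h : IsSaddlePoint Ω lam s) (t : ℝ) :
    charFun (tiltedScoreLaw σ Ω lam s a) t
      = Complex.exp ((((K * m : ℕ) / 2 * α Ω lam s + (K * m : ℕ) * modExponent Ω s t : ℝ) : ℂ)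
        + (((K * m : ℕ) * phaseExponent Ω s t : ℝ) : ℂ) * Complex.I) := by
  rw [← integral_tilted hK hσ hΩ ha h, charFun_apply_real, tiltedScoreLaw,
    integral_map (continuous_score lam).measurable.aemeasurable
      (Continuous.aestronglyMeasurable (by fun_prop)),
    integral_withDensity_eq_integral_toReal_smul measurable_tilted.ennreal_ofReal
      (Filter.Eventually.of_forall fun x => ENNReal.ofReal_lt_top)]
  congr 1
  funext b
  have := outputPDF_pos hσ hΩ b
  rw [ENNReal.toReal_ofReal (by positivity), Complex.real_smul]

/-- The modulus is at most a constant times `(1 + (w t) ^ 2) ^ (-n / 4)`; the condition `n ≥ 4`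
makes this integrable by comparison with a Cauchy density. -/
theorem integrable_charFun_tiltedScoreLaw (hK : 0 < K) (hσ : ∀ k, 0 < σ k) (hΩ : ∀ k, 0 < Ω k)
    (ha : ∀ k, ‖a k‖ ^ 2 = m * (Ω k * σ k ^ 2)) (h : IsSaddlePoint Ω lam s) (hn : 4 ≤ K * m) :
    Integrable (charFun (tiltedScoreLaw σ Ω lam s a)) := by
  obtain ⟨w, hw, hdecay⟩ := exists_modExponent_le hK hΩ h.1
  rw [funext (charFun_tiltedScoreLaw hK hσ hΩ ha h)]
  have hc1 := continuous_modExponent (Ω := Ω) (s := s)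
  have hc2 := continuous_phaseExponent (Ω := Ω) (s := s)
  have hn' : (4 : ℝ) ≤ (K * m : ℕ) := by exact_mod_cast hn
  refine ((integrable_inv_one_add_sq.comp_mul_left' hw.ne').const_mul
    (Real.exp ((K * m : ℕ) / 2 * α Ω lam s))).mono'
    (Continuous.aestronglyMeasurable (by fun_prop)) (Filter.Eventually.of_forall fun t => ?_)
  have h0 : 0 < 1 + (w * t) ^ 2 := by positivity
  have hl : 0 ≤ Real.log (1 + (w * t) ^ 2) := Real.log_nonneg (by linarith [sq_nonneg (w * t)])
  rw [Complex.exp_add, norm_mul, Complex.norm_exp_ofReal_mul_I, mul_one, ← Complex.ofReal_exp,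
    Complex.norm_real, Real.norm_eq_abs, Real.abs_exp, Real.exp_add]
  gcongr
  rw [← Real.exp_log (inv_pos.2 h0), Real.log_inv, Real.exp_le_exp]
  calc ((K * m : ℕ) : ℝ) * modExponent Ω s t
      ≤ (K * m : ℕ) * (-(Real.log (1 + (w * t) ^ 2) / 4)) := by gcongr; exact hdecay t
    _ ≤ -Real.log (1 + (w * t) ^ 2) := by nlinarith

-- Writing `c + i t = c (1 + i t / c)` in polar form subtracts a logarithm from the modulus and an
-- arctangent from the phase, whence `e = 1 / c`.
open Complex in
theorem re_one_div_mul_charFun (hK : 0 < K) (hσ : ∀ k, 0 < σ k) (hΩ : ∀ k, 0 < Ω k)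
    (ha : ∀ k, ‖a k‖ ^ 2 = m * (Ω k * σ k ^ 2)) (h : IsSaddlePoint Ω lam s) {c : ℝ} (hc : c ≠ 0)
    (t : ℝ) :
    (1 / (c + t * I) * charFun (tiltedScoreLaw σ Ω lam s a) t).re
      = Real.exp ((K * m : ℕ) / 2 * α Ω lam s) / c
        * saddleIntegrand (modExponent Ω s) (phaseExponent Ω s) (1 / c) (K * m : ℕ) t := by
  have hcc : (c : ℂ) ≠ 0 := by exact_mod_cast hc
  have h1 : (c + t * I : ℂ) = c * (1 + ((1 / c * t : ℝ) : ℂ) * I) := by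
    push_cast; field_simp
  rw [charFun_tiltedScoreLaw hK hσ hΩ ha h, h1, one_add_mul_I_eq_exp, one_div, mul_inv,
    ← Complex.exp_neg, mul_assoc, ← Complex.exp_add, saddleIntegrand]
  set A := ((K * m : ℕ) : ℝ) / 2 * α Ω lam s
  set R := ((K * m : ℕ) : ℝ) * modExponent Ω s t
  set J := ((K * m : ℕ) : ℝ) * phaseExponent Ω s t
  set L := Real.log (1 + (1 / c * t) ^ 2) / 2
  set T := Real.arctan (1 / c * t)
  have h2 : -((L : ℂ) + T * I) + (((A + R : ℝ) : ℂ) + J * I)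
      = ((A + (R - L) : ℝ) : ℂ) + ((J - T : ℝ) : ℂ) * I := by
    push_cast; ring
  rw [h2, Complex.exp_add, ← Complex.ofReal_inv, re_ofReal_mul, ← Complex.ofReal_exp,
    re_ofReal_mul, Complex.exp_ofReal_mul_I_re, Real.exp_add]
  ring

/-- The false alarm probability as a saddle point integral. -/
theorem probFA_eq (hK : 0 < K) (hn : 4 ≤ K * m) (hσ : ∀ k, 0 < σ k) (hΩ : ∀ k, 0 < Ω k)
    (ha : ∀ k, ‖a k‖ ^ 2 = m * (Ω k * σ k ^ 2)) (h : IsSaddlePoint Ω lam s) (hs : 0 < s) :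
    probFA σ Ω a (threshold Ω lam) = Real.exp ((K * m : ℕ) / 2 * α Ω lam s)
      * (1 / (2 * Real.pi * |s|) * ∫ t, saddleIntegrand (modExponent Ω s) (phaseExponent Ω s)
          (1 / s) (K * m : ℕ) t) := by
  have hm : 0 < m := Nat.pos_of_ne_zero fun h => by simp [h] at hn
  have hn0 : (0 : ℝ) < (K * m : ℕ) := by exact_mod_cast Nat.mul_pos hK hm
  have hfin := isFiniteMeasure_tilted hK hσ hΩ ha h
  have : IsFiniteMeasure (tiltedScoreLaw σ Ω lam s a) := by
    unfold tiltedScoreLaw; infer_instance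
  have hset : {b | threshold Ω lam ≤ logLikelihood σ Ω a b}
      = score σ Ω lam a ⁻¹' Set.Ici 0 := by
    ext b
    rw [Set.mem_ofPred_eq, logLikelihood_eq hK hm lam hσ hΩ ha, Set.mem_preimage, Set.mem_Ici,
      le_add_iff_nonneg_right, mul_nonneg_iff_of_pos_left (by positivity)]
  rw [probFA, hset, outputLaw, withDensity_real_preimage (C := 1) (c := s) volume
    continuous_outputPDF.measurable (measurable_tilted (s := s) (lam := lam) (a := a))
    (continuous_score lam).measurable
    (fun b => (outputPDF_pos hσ hΩ b).le)
    (fun b => mul_nonneg (outputPDF_pos hσ hΩ b).le (Real.exp_pos _).le)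
    (fun b => by rw [mul_assoc, ← Real.exp_add]; simp) measurableSet_Ici]
  have := integral_Ici_exp_neg_eq (integrable_charFun_tiltedScoreLaw hK hσ hΩ ha h hn) hs
  rw [← tiltedScoreLaw, this]
  simp_rw [re_one_div_mul_charFun hK hσ hΩ ha h hs.ne']
  rw [integral_const_mul, abs_of_pos hs]
  field_simp

/-- The missed detection probability as a saddle point integral. -/
theorem probMD_eq (hK : 0 < K) (hn : 4 ≤ K * m) (hσ : ∀ k, 0 < σ k) (hΩ : ∀ k, 0 < Ω k)
    (ha : ∀ k, ‖a k‖ ^ 2 = m * (Ω k * σ k ^ 2)) (h : IsSaddlePoint Ω lam s)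
    (hs : s - 1 / 2 < 0) :
    probMD σ Ω a (threshold Ω lam) = Real.exp ((K * m : ℕ) / 2 * β Ω lam (s - 1 / 2))
      * (1 / (2 * Real.pi * |s - 1 / 2|)
        * ∫ t, saddleIntegrand (modExponent Ω s) (phaseExponent Ω s)
          (1 / (s - 1 / 2)) (K * m : ℕ) t) := by
  have hm : 0 < m := Nat.pos_of_ne_zero fun h => by simp [h] at hn
  have hn0 : (0 : ℝ) < (K * m : ℕ) := by exact_mod_cast Nat.mul_pos hK hm
  have hfin := isFiniteMeasure_tilted hK hσ hΩ ha h
  have : IsFiniteMeasure (tiltedScoreLaw σ Ω lam s a) := by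
    unfold tiltedScoreLaw; infer_instance
  have hset : {b | logLikelihood σ Ω a b < threshold Ω lam}
      = score σ Ω lam a ⁻¹' Set.Iio 0 := by
    ext b
    rw [Set.mem_ofPred_eq, logLikelihood_eq hK hm lam hσ hΩ ha, Set.mem_preimage, Set.mem_Iio,
      add_lt_iff_neg_left, ← not_le, ← not_le, mul_nonneg_iff_of_pos_left (by positivity)]
  have hch : channelPDF σ a = fun b => outputPDF σ Ω b
      * Real.exp ((K * m : ℕ) * threshold Ω lam + score σ Ω lam a b / 2) :=
    funext (channelPDF_eq hK lam hσ hΩ ha)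
  -- The channel density already carries `exp (S / 2)`, so only `s - 1/2` of the tilt has to be
  -- undone.
  rw [probMD, hset, channelLaw, withDensity_real_preimage
    (C := Real.exp ((K * m : ℕ) * threshold Ω lam)) (c := s - 1 / 2) volume
    (by
      rw [hch]
      exact (continuous_outputPDF.mul
        (((continuous_score lam).div_const 2).const_add _).rexp).measurable)
    (measurable_tilted (s := s) (lam := lam) (a := a)) (continuous_score lam).measurable
    (fun b => by
      rw [hch]; exact mul_nonneg (outputPDF_pos hσ hΩ b).le (Real.exp_pos _).le)
    (fun b => mul_nonneg (outputPDF_pos hσ hΩ b).le (Real.exp_pos _).le)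
    (fun b => by
      simp only [hch]
      rw [mul_assoc (outputPDF σ Ω b), ← Real.exp_add, mul_left_comm, ← Real.exp_add]
      congr 2
      ring) measurableSet_Iio]
  have := integral_Iio_exp_neg_eq (integrable_charFun_tiltedScoreLaw hK hσ hΩ ha h hn) hs
  rw [← tiltedScoreLaw, this]
  simp_rw [re_one_div_mul_charFun hK hσ hΩ ha h hs.ne]
  rw [integral_const_mul, abs_of_neg hs]
  -- The constant by which `β` differs from the shifted `α` is twice the threshold.
  have hβ : Real.exp ((K * m : ℕ) / 2 * β Ω lam (s - 1 / 2)) =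
      Real.exp ((K * m : ℕ) * threshold Ω lam) * Real.exp ((K * m : ℕ) / 2 * α Ω lam s) := by
    rw [← Real.exp_add, β, sub_add_cancel, threshold]
    congr 1
    ring
  rw [hβ]
  have := hs.ne
  field_simp

end

/-! ### Logarithms and conclusion. -/

theorem abs_log_sub_log_le {x y : ℝ} (hx : 1 / 2 ≤ x) (hy : 1 / 2 ≤ y) :
    |Real.log x - Real.log y| ≤ 2 * |x - y| := by
  wlog hxy : y ≤ x generalizing x y
  · rw [abs_sub_comm, abs_sub_comm x]
    exact this hy hx (le_of_not_ge hxy)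
  have hx0 : 0 < x := by linarith
  have hy0 : 0 < y := by linarith
  rw [← Real.log_div hx0.ne' hy0.ne',
    abs_of_nonneg (Real.log_nonneg ((one_le_div hy0).2 hxy)),
    abs_of_nonneg (show 0 ≤ x - y by linarith)]
  have := Real.log_le_sub_one_of_pos (div_pos hx0 hy0)
  have h1 : x / y - 1 = (x - y) / y := by field_simp
  have h2 : (x - y) / y ≤ 2 * (x - y) := by
    rw [div_le_iff₀ hy0]; nlinarith
  linarith

/-- Taking logarithms in a second order asymptotic expansion. -/
theorem log_expansion (G : ℝ) {B : ℝ} (hB : 0 ≤ B) :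
    ∃ B', 0 ≤ B' ∧ ∃ N : ℝ, ∀ n r v E P : ℝ, N ≤ n → 1 ≤ n → 0 < v →
      |r - (1 + G / n)| ≤ B / n ^ 2 → P = Real.exp (n / 2 * E) * (1 / √v * r) →
      0 < P ∧ 0 < 1 + 1 / n * G ∧
      |1 / n * Real.log P - (1 / 2 * E - 1 / (2 * n) * Real.log v)| ≤ B' / n ^ 2 ∧
      |1 / n * Real.log P - (1 / 2 * E - 1 / (2 * n) * Real.log v
        + 1 / n * Real.log (1 + 1 / n * G))| ≤ B' / n ^ 3 := by
  -- For such `n` both `|G / n|` and `B / n ^ 2` are at most `1/4`, so `r` and `1 + G / n` stay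
  -- above `1/2`, where `log` is `2`-Lipschitz.
  refine ⟨2 * B + 2 * |G|, by positivity, 4 * |G| + 4 * B, fun n r v E P hN hn hv hr hP => ?_⟩
  have hn0 : 0 < n := by linarith
  have hG : |G / n| ≤ 1 / 4 := by
    rw [abs_div, abs_of_pos hn0, div_le_iff₀ hn0]; linarith
  have hG' := abs_le.1 hG
  have hBn : B / n ^ 2 ≤ 1 / 4 := by
    rw [div_le_iff₀ (by positivity)]; nlinarith [abs_nonneg G]
  have hr' := abs_le.1 hr
  have hr2 : 1 / 2 ≤ r := by linarith
  have hr0 : 0 < r := by linarith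
  have hsv : 0 < √v := Real.sqrt_pos.2 hv
  have e1 : 1 / n * G = G / n := by ring
  have hlogP : Real.log P = n / 2 * E - 1 / 2 * Real.log v + Real.log r := by
    rw [hP, Real.log_mul (Real.exp_pos _).ne' (by positivity), Real.log_exp,
      Real.log_mul (by positivity) hr0.ne', one_div, Real.log_inv, Real.log_sqrt hv.le]
    ring
  have h1 := abs_log_sub_log_le hr2 (show 1 / 2 ≤ 1 + G / n by linarith)
  have h2 := abs_log_sub_log_le (show 1 / 2 ≤ 1 + G / n by linarith) (show 1 / 2 ≤ (1 : ℝ) by norm_num)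
  rw [Real.log_one, sub_zero, add_sub_cancel_left, abs_div, abs_of_pos hn0] at h2
  rw [e1]
  refine ⟨by rw [hP]; positivity, by linarith, ?_, ?_⟩
  · have e2 : 1 / n * Real.log P - (1 / 2 * E - 1 / (2 * n) * Real.log v)
        = ((Real.log r - Real.log (1 + G / n)) + Real.log (1 + G / n)) / n := by
      rw [hlogP]; field_simp; ring
    rw [e2, abs_div, abs_of_pos hn0, div_le_div_iff₀ hn0 (by positivity)]
    have h3 : B / n ^ 2 ≤ B / n := by
      gcongr; nlinarith
    have h4 : |(Real.log r - Real.log (1 + G / n)) + Real.log (1 + G / n)|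
        ≤ (2 * B + 2 * |G|) / n := by
      refine (abs_add_le _ _).trans ?_
      rw [add_div, mul_div_assoc, mul_div_assoc]
      linarith
    calc _ ≤ (2 * B + 2 * |G|) / n * n ^ 2 := by gcongr
      _ = _ := by field_simp
  · have e2 : 1 / n * Real.log P - (1 / 2 * E - 1 / (2 * n) * Real.log v
        + 1 / n * Real.log (1 + G / n)) = (Real.log r - Real.log (1 + G / n)) / n := by
      rw [hlogP]; field_simp; ring
    rw [e2, abs_div, abs_of_pos hn0, div_le_div_iff₀ hn0 (by positivity)]
    calc _ ≤ 2 * (B / n ^ 2) * n ^ 3 := by gcongr; linarith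
      _ = 2 * B * n := by field_simp
      _ ≤ _ := by gcongr; linarith [abs_nonneg G]

/-- Both error probabilities are of the form treated here, with `c = sα` or `c = sβ`. -/
theorem saddle_expansion {K : ℕ} (hK : 0 < K) {Ω : Fin K → ℝ} (hΩ : ∀ k, 0 < Ω k) {lam s : ℝ}
    (h : IsSaddlePoint Ω lam s) {c : ℝ} (hc : c ≠ 0) :
    ∃ B, 0 ≤ B ∧ ∃ N : ℝ, ∀ n E P : ℝ, N ≤ n → 4 ≤ n →
      P = Real.exp (n / 2 * E) * (1 / (2 * Real.pi * |c|)
        * ∫ t, saddleIntegrand (modExponent Ω s) (phaseExponent Ω s) (1 / c) n t) →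
      0 < P ∧ 0 < 1 + 1 / n * g Ω s c ∧
      |1 / n * Real.log P - approx₁ Ω s E c n| ≤ B / n ^ 2 ∧
      |1 / n * Real.log P - approx₂ Ω s E c n| ≤ B / n ^ 3 := by
  obtain ⟨w, hw, hdecay⟩ := exists_modExponent_le hK hΩ h.1
  have ha2 := taylorCoeff_two_pos hK hΩ h.1
  obtain ⟨B, hB, hint⟩ := abs_integral_saddleIntegrand_sub_le (1 / c) ha2 hw
    (taylorBound_nonneg hΩ h.1) continuous_modExponent continuous_phaseExponent
    (abs_modExponent_sub_le hΩ h.1) (abs_phaseExponent_add_le hΩ h.1) hdecay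
  obtain ⟨B', hB', N, hN⟩ := log_expansion (g Ω s c) hB
  refine ⟨B', hB', N, fun n E P hn hn4 hP => ?_⟩
  have hn0 : 0 < n := by linarith
  set a2 := taylorCoeff Ω s 2 with ha2def
  set I := ∫ t, saddleIntegrand (modExponent Ω s) (phaseExponent Ω s) (1 / c) n t with hI
  have hq : 0 < √(Real.pi / (a2 / 2 * n)) := by positivity
  have hcpos : 0 < |c| := abs_pos.2 hc
  have hgeq : (12 * a2 * taylorCoeff Ω s 4 - 15 * taylorCoeff Ω s 3 ^ 2) / (8 * a2 ^ 3)
      - 3 * taylorCoeff Ω s 3 / (2 * a2 ^ 2) * (1 / c) - (1 / c) ^ 2 / a2 = g Ω s c := by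
    rw [g, ← ha2def]
    field_simp
  have hr : |I / √(Real.pi / (a2 / 2 * n)) - (1 + g Ω s c / n)| ≤ B / n ^ 2 := by
    have := hint n hn4
    rw [hgeq, ← hI] at this
    have e : I - √(Real.pi / (a2 / 2 * n)) * (1 + g Ω s c / n)
        = √(Real.pi / (a2 / 2 * n)) * (I / √(Real.pi / (a2 / 2 * n)) - (1 + g Ω s c / n)) := by
      field_simp
    rw [e, abs_mul, abs_of_pos hq] at this
    exact le_of_mul_le_mul_left this hq
  -- The inversion prefactor and the Gaussian mass combine into the argument of the logarithm in
  -- `approx₁`.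
  have hv : 1 / (2 * Real.pi * |c|) * √(Real.pi / (a2 / 2 * n))
      = 1 / √(2 * Real.pi * n * a2 * c ^ 2) := by
    rw [eq_div_iff (by positivity), mul_assoc, ← Real.sqrt_mul (by positivity)]
    have : Real.pi / (a2 / 2 * n) * (2 * Real.pi * n * a2 * c ^ 2) = (2 * Real.pi * |c|) ^ 2 := by
      rw [mul_pow, sq_abs]; field_simp
    rw [this, Real.sqrt_sq (by positivity)]
    field_simp
  refine hN n _ (2 * Real.pi * n * a2 * c ^ 2) E P hn (by linarith) (by positivity) hr ?_
  rw [hP, ← hv]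
  field_simp

end ParallelAWGN

theorem mainTheorem7 (K : ℕ) (hK : 0 < K) (Ω : Fin K → ℝ) (hΩ : ∀ k, 0 < Ω k)
    (lam sα sβ : ℝ) (hsα : ParallelAWGN.IsSaddlePoint Ω lam sα) (hsβ : sβ = sα - 1 / 2)
    (hβ0 : sβ < 0) (h0α : 0 < sα) :
    ∃ B : ℝ, ∃ N : ℕ, ∀ P σ : Fin K → ℝ, (∀ k, 0 < P k) → (∀ k, 0 < σ k) →
      (∀ k, Ω k = P k / σ k ^ 2) →
      ∀ n m : ℕ, n = K * m → N ≤ n → ∀ a ∈ ParallelAWGN.codewords m P,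
        0 < ParallelAWGN.probFA σ Ω a (ParallelAWGN.threshold Ω lam) ∧
        0 < ParallelAWGN.probMD σ Ω a (ParallelAWGN.threshold Ω lam) ∧
        0 < 1 + 1 / (n : ℝ) * ParallelAWGN.g Ω sα sα ∧
        0 < 1 + 1 / (n : ℝ) * ParallelAWGN.g Ω sα sβ ∧
        |1 / (n : ℝ) * Real.log (ParallelAWGN.probFA σ Ω a (ParallelAWGN.threshold Ω lam))
            - ParallelAWGN.approx₁ Ω sα (ParallelAWGN.α Ω lam sα) sα n| ≤ B / (n : ℝ) ^ 2 ∧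
        |1 / (n : ℝ) * Real.log (ParallelAWGN.probMD σ Ω a (ParallelAWGN.threshold Ω lam))
            - ParallelAWGN.approx₁ Ω sα (ParallelAWGN.β Ω lam sβ) sβ n| ≤ B / (n : ℝ) ^ 2 ∧
        |1 / (n : ℝ) * Real.log (ParallelAWGN.probFA σ Ω a (ParallelAWGN.threshold Ω lam))
            - ParallelAWGN.approx₂ Ω sα (ParallelAWGN.α Ω lam sα) sα n| ≤ B / (n : ℝ) ^ 3 ∧
        |1 / (n : ℝ) * Real.log (ParallelAWGN.probMD σ Ω a (ParallelAWGN.threshold Ω lam))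
            - ParallelAWGN.approx₂ Ω sα (ParallelAWGN.β Ω lam sβ) sβ n| ≤ B / (n : ℝ) ^ 3 := by
  subst hsβ
  obtain ⟨B₁, hB₁, N₁, h₁⟩ := ParallelAWGN.saddle_expansion hK hΩ hsα h0α.ne'
  obtain ⟨B₂, hB₂, N₂, h₂⟩ := ParallelAWGN.saddle_expansion hK hΩ hsα hβ0.ne
  refine ⟨B₁ + B₂, max 4 (max ⌈N₁⌉₊ ⌈N₂⌉₊), ?_⟩
  rintro P σ hP hσ hPσ n m rfl hN a ha
  have hn4 : 4 ≤ K * m := (le_max_left _ _).trans hN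
  have hn4' : (4 : ℝ) ≤ (K * m : ℕ) := by exact_mod_cast hn4
  have hN₁ : N₁ ≤ (K * m : ℕ) :=
    Nat.ceil_le.1 (((le_max_left _ _).trans (le_max_right _ _)).trans hN)
  have hN₂ : N₂ ≤ (K * m : ℕ) :=
    Nat.ceil_le.1 (((le_max_right _ _).trans (le_max_right _ _)).trans hN)
  -- The energy constraint in terms of `Ω` and `σ` is all that is used about the codeword; the
  -- constants were chosen before it.
  have ha' (k : Fin K) : ‖a k‖ ^ 2 = m * (Ω k * σ k ^ 2) := by
    have := (hσ k).ne'
    rw [ha k, hPσ k]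
    field_simp
  obtain ⟨p1, g1, a1, b1⟩ := h₁ _ _ _ hN₁ hn4'
    (ParallelAWGN.probFA_eq hK hn4 hσ hΩ ha' hsα h0α)
  obtain ⟨p2, g2, a2, b2⟩ := h₂ _ _ _ hN₂ hn4'
    (ParallelAWGN.probMD_eq hK hn4 hσ hΩ ha' hsα hβ0)
  exact ⟨p1, p2, g1, g2, a1.trans (by gcongr; linarith), a2.trans (by gcongr; linarith),
    b1.trans (by gcongr; linarith), b2.trans (by gcongr; linarith)⟩
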